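/- Let $\ell\ge 1$. An $\ell$-fold multi-index is a sequence $\mathbf n=(n_1,\dots,n_\ell)$ of nonnegative integers; $\mathbf e_p$ denotes the multi-index with $1$ in position $p$ and $0$ elsewhere. An $\ell$-fold multisemisimplicial set $X$ is a collection of sets $X_{\mathbf n}$, indexed by the $\ell$-fold multi-indices, with face maps $d_i^p:X_{\mathbf n}\to X_{\mathbf n-\mathbf e_p}$ for $1\le p\le \ell$ with $n_p\ge 1$ and $0\le i\le n_p$, such that $d_i^pd_j^p=d_{j-1}^pd_i^p$ for $i<j$ and $d_i^pd_j^q=d_j^qd_i^p$ for $p\ne q$. It satisfies the Kan condition if, for every multi-index $\mathbf n$, every pair $(r,k)$ with $1\le r\le \ell$, $n_r\ge 1$ and $0\le k\le n_r$, and all elements $x_i^p\in X_{\mathbf n-\mathbf e_p}$ (one for each $(p,i)\ne(r,k)$ with $n_p\ge1$ and $0\le i\le n_p$) satisfying $d_i^px_j^p=d_{j-1}^px_i^p$ for $i<j$ and $d_i^px_j^q=d_j^qx_i^p$ for $p\neq q$ (whenever these expressions are defined), there is an $x\in X_{\mathbf n}$ with $d_i^px=x_i^p$ for all $(p,i)\ne(r,k)$.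 Theorem. Let $X$ be an $\ell$-fold multisemisimplicial set satisfying the Kan condition. Then there are functions $s_j^q:X_{\mathbf n}\to X_{\mathbf n+\mathbf e_q}$, for every multi-index $\mathbf n$, $1\le q\le\ell$ and $0\le j\le n_q$, such that \begin{align*} d_i^qs_j^q&=s_{j-1}^qd_i^q &&\text{if } i<j,\\ d_i^qs_j^qx&=x &&\text{if } i=j,\,j+1,\\ d_i^qs_j^q&=s_j^qd_{i-1}^q &&\text{if } i>j+1,\\ s_j^qs_i^q&=s_i^qs_{j-1}^q &&\text{if } i<j,\\ d_i^ps_j^q&=s_j^qd_i^p &&\text{whenever } p\ne q,\\ s_i^ps_j^q&=s_j^qs_i^p &&\text{whenever } p\ne q. \end{align*} -/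

import Mathlib

universe u

/-- The multi-index with `1` in position `p` and `0` in all other positions. -/
def multiE {l : ℕ} (p : Fin l) : Fin l → ℕ := Pi.single p 1

/-- An `l`-fold multisemisimplicial set: sets `obj n` indexed by the `l`-fold multi-indices `n`,
with face maps `d_i^p : X_m → X_{m - e_p}` for `0 ≤ i ≤ m_p` (whenever `m - e_p` is a multi-index).
The target index `m - e_p` is written as a multi-index `n` with `m = n + e_p`; such an `n` is
unique, so there is exactly one map for each `m`, `p`, `i`. The bounds on the indices are arguments
of the maps; in the identities, those of the right-hand sides follow from the others. -/
structure MultiSemiSimplicialSet (l : ℕ) where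
  /-- The set `X_n`. -/
  obj : (Fin l → ℕ) → Type u
  /-- The face map `d_i^p`. -/
  d : ∀ (p : Fin l) {m n : Fin l → ℕ}, m = n + multiE p →
    ∀ i : ℕ, i ≤ m p → obj m → obj n
  /-- `d_i^p d_j^p = d_{j-1}^p d_i^p` for `i < j`. -/
  d_d_same : ∀ (p : Fin l) {m n k : Fin l → ℕ} (hm : m = n + multiE p) (hn : n = k + multiE p)
    (i j : ℕ) (_ : i < j) (hj : j ≤ m p) (hi : i ≤ n p) (hi' : i ≤ m p) (hj' : j - 1 ≤ n p)
    (x : obj m),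
    d p hn i hi (d p hm j hj x) = d p hn (j - 1) hj' (d p hm i hi' x)
  /-- `d_i^p d_j^q = d_j^q d_i^p` for `p ≠ q`. -/
  d_d_ne : ∀ (p q : Fin l) (_ : p ≠ q) {m n n' k : Fin l → ℕ}
    (hm : m = n + multiE q) (hn : n = k + multiE p)
    (hm' : m = n' + multiE p) (hn' : n' = k + multiE q)
    (i j : ℕ) (hj : j ≤ m q) (hi : i ≤ n p) (hi' : i ≤ m p) (hj' : j ≤ n' q) (x : obj m),
    d p hn i hi (d q hm j hj x) = d q hn' j hj' (d p hm' i hi' x)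

/-- The Kan condition: every consistent choice of all but one of the faces of a multisimplex of
multi-index `n` comes from an element of `X_n`. The omitted face is `(r, k)`, which is a face of
such a multisimplex exactly when `1 ≤ n r` and `k ≤ n r`. The chosen faces `x_i^p ∈ X_{n - e_p}`
are `x p h i hi ne`, where `h : n = c + e_p`, `hi : i ≤ n_p` and `ne : (p, i) ≠ (r, k)`. -/
def MultiSemiSimplicialSet.IsKan {l : ℕ} (X : MultiSemiSimplicialSet.{u} l) : Prop :=
  ∀ (n : Fin l → ℕ) (r : Fin l) (k : ℕ), 1 ≤ n r → k ≤ n r →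
  ∀ x : (∀ (p : Fin l) {c : Fin l → ℕ}, n = c + multiE p →
      ∀ i : ℕ, i ≤ n p → (p, i) ≠ (r, k) → X.obj c),
    -- `d_i^p x_j^p = d_{j-1}^p x_i^p` for `i < j`
    (∀ (p : Fin l) {b c : Fin l → ℕ} (hb : n = b + multiE p) (hc : b = c + multiE p)
      (i j : ℕ) (_ : i < j) (hj : j ≤ n p) (hi : i ≤ b p) (hi' : i ≤ n p) (hj' : j - 1 ≤ b p)
      (nej : (p, j) ≠ (r, k)) (nei : (p, i) ≠ (r, k)),
      X.d p hc i hi (x p hb j hj nej) = X.d p hc (j - 1) hj' (x p hb i hi' nei)) →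
    -- `d_i^p x_j^q = d_j^q x_i^p` for `p ≠ q`
    (∀ (p q : Fin l) (_ : p ≠ q) {b b' c : Fin l → ℕ}
      (hb : n = b + multiE q) (hc : b = c + multiE p)
      (hb' : n = b' + multiE p) (hc' : b' = c + multiE q)
      (i j : ℕ) (hj : j ≤ n q) (hi : i ≤ b p) (hi' : i ≤ n p) (hj' : j ≤ b' q)
      (nej : (q, j) ≠ (r, k)) (nei : (p, i) ≠ (r, k)),
      X.d p hc i hi (x q hb j hj nej) = X.d q hc' j hj' (x p hb' i hi' nei)) →
    ∃ y : X.obj n, ∀ (p : Fin l) {c : Fin l → ℕ} (h : n = c + multiE p) (i : ℕ) (hi : i ≤ n p)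
      (ne : (p, i) ≠ (r, k)), X.d p h i hi y = x p h i hi ne

namespace MultiSemiSimplicialSet

universe v

variable {l : ℕ}

theorem apply_of_eq_add_multiE {p : Fin l} {m n : Fin l → ℕ} (h : m = n + multiE p) (q : Fin l) :
    m q = n q + if q = p then 1 else 0 := by
  subst h
  simp [multiE, Pi.single_apply]

/-! ### Partial maps and their extension along horns -/

/-- A family of simplices is closed when it contains the faces of its members. -/
def FaceClosed (Y : MultiSemiSimplicialSet.{v} l) (D : ∀ n, Y.obj n → Prop) : Prop :=
  ∀ (p : Fin l) {m n : Fin l → ℕ} (h : m = n + multiE p) (i : ℕ) (hi : i ≤ m p) (y : Y.obj m),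
    D m y → D n (Y.d p h i hi y)

/-- A map to `X`, compatible with faces, that is defined on the simplices of `Y` satisfying `D`. -/
structure PartialHom (Y : MultiSemiSimplicialSet.{v} l) (X : MultiSemiSimplicialSet.{u} l)
    (D : ∀ n, Y.obj n → Prop) where
  /-- The underlying function. -/
  app : ∀ {n : Fin l → ℕ} (y : Y.obj n), D n y → X.obj n
  /-- Compatibility with face maps. -/
  comm : ∀ (p : Fin l) {m n : Fin l → ℕ} (h : m = n + multiE p) (i : ℕ) (hi : i ≤ m p)
    (y : Y.obj m) (hy : D m y) (hy' : D n (Y.d p h i hi y)),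
    X.d p h i hi (app y hy) = app (Y.d p h i hi y) hy'

namespace PartialHom

variable {Y : MultiSemiSimplicialSet.{v} l} {X : MultiSemiSimplicialSet.{u} l}

theorem app_congr {D : ∀ n, Y.obj n → Prop} (f : PartialHom Y X D) {n : Fin l → ℕ}
    {y y' : Y.obj n} (e : y = y') (hy : D n y) (hy' : D n y') : f.app y hy = f.app y' hy' := by
  subst e
  rfl

/-- A functional relation that is compatible with faces defines a partial map. -/
theorem exists_of_rel {D : ∀ n, Y.obj n → Prop} (R : ∀ n, Y.obj n → X.obj n → Prop)
    (total : ∀ n y, D n y → ∃ z, R n y z)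
    (unique : ∀ n y z z', R n y z → R n y z' → z = z')
    (face : ∀ (p : Fin l) {m n : Fin l → ℕ} (h : m = n + multiE p) (i : ℕ) (hi : i ≤ m p) y z,
      R m y z → R n (Y.d p h i hi y) (X.d p h i hi z)) :
    ∃ f : PartialHom Y X D, ∀ n y (hy : D n y) z, R n y z → f.app y hy = z := by
  choose F hF using total
  refine ⟨⟨fun {n} y hy => F n y hy, ?_⟩, ?_⟩
  · intro p m n h i hi y hy hy'
    exact unique _ _ _ _ (face p h i hi _ _ (hF m y hy)) (hF n _ hy')
  · intro n y hy z hz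
    exact unique _ _ _ _ (hF n y hy) hz

/-- Partial maps that agree where both are defined can be glued. -/
theorem exists_glue {D D' : ∀ n, Y.obj n → Prop} (hD : FaceClosed Y D) (hD' : FaceClosed Y D')
    (f : PartialHom Y X D) (f' : PartialHom Y X D')
    (agree : ∀ n y (hy : D n y) (hy' : D' n y), f.app y hy = f'.app y hy') :
    ∃ g : PartialHom Y X (fun n y => D n y ∨ D' n y),
      ∀ n y (hy : D n y), g.app y (Or.inl hy) = f.app y hy := by
  obtain ⟨g, hg⟩ := exists_of_rel (Y := Y) (X := X) (D := fun n y => D n y ∨ D' n y)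
    (fun n y z => (∃ hy : D n y, f.app y hy = z) ∨ (∃ hy : D' n y, f'.app y hy = z))
    (by
      rintro n y (hy | hy)
      · exact ⟨_, Or.inl ⟨hy, rfl⟩⟩
      · exact ⟨_, Or.inr ⟨hy, rfl⟩⟩)
    (by
      rintro n y z z' (⟨hy, rfl⟩ | ⟨hy, rfl⟩) (⟨hy', rfl⟩ | ⟨hy', rfl⟩)
      · rfl
      · exact agree _ _ _ _
      · exact (agree _ _ _ _).symm
      · rfl)
    (by
      rintro p m n h i hi y z (⟨hy, rfl⟩ | ⟨hy, rfl⟩)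
      · exact Or.inl ⟨hD p h i hi y hy, (f.comm p h i hi y hy _).symm⟩
      · exact Or.inr ⟨hD' p h i hi y hy, (f'.comm p h i hi y hy _).symm⟩)
  exact ⟨g, fun n y hy => hg n y _ _ (Or.inl ⟨hy, rfl⟩)⟩

/-- Successive extensions along an increasing sequence of families extend to the union. -/
theorem exists_extend_iUnion (D : ℕ → ∀ n, Y.obj n → Prop) (hD : ∀ N, FaceClosed Y (D N))
    (mono : ∀ N n y, D N n y → D (N + 1) n y)
    (step : ∀ N (f : PartialHom Y X (D N)), ∃ g : PartialHom Y X (D (N + 1)),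
      ∀ n y (hy : D N n y) (hy' : D (N + 1) n y), g.app y hy' = f.app y hy)
    (f : PartialHom Y X (D 0)) :
    ∃ g : PartialHom Y X (fun n y => ∃ N, D N n y),
      ∀ n y (hy : D 0 n y), g.app y ⟨0, hy⟩ = f.app y hy := by
  choose G hG using step
  let F : ∀ N, PartialHom Y X (D N) := fun N => Nat.rec f G N
  have mono' : ∀ {M N : ℕ}, M ≤ N → ∀ n y, D M n y → D N n y := by
    intro M N h
    induction h with
    | refl => exact fun _ _ h => h
    | step _ ih => exact fun n y h => mono _ _ _ (ih n y h)
  have coh : ∀ {M N : ℕ}, M ≤ N → ∀ n y (hy : D M n y) (hy' : D N n y),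
      (F N).app y hy' = (F M).app y hy := by
    intro M N h
    induction h with
    | refl => exact fun _ _ _ _ => rfl
    | step hN ih =>
      intro n y hy hy'
      rw [← ih n y hy (mono' hN n y hy)]
      exact hG _ _ n y _ _
  obtain ⟨g, hg⟩ := exists_of_rel (Y := Y) (X := X) (D := fun n y => ∃ N, D N n y)
    (fun n y z => ∃ N, ∃ hy : D N n y, (F N).app y hy = z)
    (fun n y ⟨N, hy⟩ => ⟨_, N, hy, rfl⟩)
    (by
      rintro n y z z' ⟨N, hy, rfl⟩ ⟨M, hy', rfl⟩
      rw [← coh (le_max_left N M) n y hy (mono' (le_max_left N M) n y hy),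
        ← coh (le_max_right N M) n y hy'])
    (by
      rintro p m n h i hi y z ⟨N, hy, rfl⟩
      exact ⟨N, hD N p h i hi y hy, ((F N).comm p h i hi y hy _).symm⟩)
  exact ⟨g, fun n y hy => hg n y _ _ ⟨0, hy, rfl⟩⟩

/-- The faces, other than the omitted one, of a simplex of `Y` map to a horn in `X`. -/
theorem exists_fill (hX : X.IsKan) {D : ∀ n, Y.obj n → Prop} (hD : FaceClosed Y D)
    (f : PartialHom Y X D) (q : Fin l) {m : Fin l → ℕ} (y : Y.obj m) (k : ℕ) (hm : 1 ≤ m q)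
    (hk : k ≤ m q)
    (hy : ∀ (p : Fin l) {n : Fin l → ℕ} (h : m = n + multiE p) (i : ℕ) (hi : i ≤ m p),
      (p, i) ≠ (q, k) → D n (Y.d p h i hi y)) :
    ∃ z : X.obj m, ∀ (p : Fin l) {n : Fin l → ℕ} (h : m = n + multiE p) (i : ℕ) (hi : i ≤ m p)
      (ne : (p, i) ≠ (q, k)), X.d p h i hi z = f.app _ (hy p h i hi ne) := by
  refine hX m q k hm hk (fun p {c} h i hi ne => f.app _ (hy p h i hi ne)) ?_ ?_
  · intro p b c hb hc i j hij hj hi hi' hj' nej nei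
    rw [f.comm p hc i hi _ _ (hD _ _ _ _ _ (hy _ _ _ _ nej)),
      f.comm p hc (j - 1) hj' _ _ (hD _ _ _ _ _ (hy _ _ _ _ nei))]
    exact f.app_congr (Y.d_d_same p hb hc i j hij hj hi hi' hj' y) _ _
  · intro p q' hpq b b' c hb hc hb' hc' i j hj hi hi' hj' nej nei
    rw [f.comm p hc i hi _ _ (hD _ _ _ _ _ (hy _ _ _ _ nej)),
      f.comm q' hc' j hj' _ _ (hD _ _ _ _ _ (hy _ _ _ _ nei))]
    exact f.app_congr (Y.d_d_ne p q' hpq hb hc hb' hc' i j hj hi hi' hj' y) _ _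

/-- A partial map to a Kan multisemisimplicial set extends over simplices whose faces, with one
exception, lie in its domain. Here `U m y k` says that `y` is such a simplex, with exceptional face
`(q, k)`. -/
theorem exists_attach (hX : X.IsKan) {D : ∀ n, Y.obj n → Prop} (hD : FaceClosed Y D)
    (f : PartialHom Y X D) (q : Fin l) (U : ∀ m, Y.obj m → ℕ → Prop)
    (pos : ∀ m y k, U m y k → 1 ≤ m q ∧ k ≤ m q)
    (notMem : ∀ {m n} (h : m = n + multiE q) y k (hk : k ≤ m q), U m y k → ¬ D n (Y.d q h k hk y))
    (notU : ∀ {m n} (h : m = n + multiE q) y k (hk : k ≤ m q) k', U m y k →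
      ¬ U n (Y.d q h k hk y) k')
    (mem : ∀ m y k, U m y k → ∀ (p : Fin l) {n : Fin l → ℕ} (h : m = n + multiE p) (i : ℕ)
      (hi : i ≤ m p), (p, i) ≠ (q, k) → D n (Y.d p h i hi y))
    (unique : ∀ {m n} (h : m = n + multiE q) y y' k k' (hk : k ≤ m q) (hk' : k' ≤ m q),
      U m y k → U m y' k' → Y.d q h k hk y = Y.d q h k' hk' y' → y = y')
    {D' : ∀ n, Y.obj n → Prop}
    (cover : ∀ n y, D' n y → D n y ∨ (∃ k, U n y k) ∨
      ∃ m, ∃ h : m = n + multiE q, ∃ y' k, ∃ hk : k ≤ m q, U m y' k ∧ Y.d q h k hk y' = y) :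
    ∃ g : PartialHom Y X D', ∀ n y (hy : D n y) (hy' : D' n y), g.app y hy' = f.app y hy := by
  -- All horns are filled independently: `y` is sent to the filler, and its exceptional face to the
  -- corresponding face of the filler.
  choose G hG using fun m y k (hU : U m y k) =>
    exists_fill hX hD f q y k (pos m y k hU).1 (pos m y k hU).2 (mem m y k hU)
  have pred : ∀ m, 1 ≤ m q → ∃ n, m = n + multiE q := fun m hm =>
    ⟨m - multiE q, by
      funext p
      by_cases hp : p = q
      · subst hp
        simp [multiE]
        omega
      · simp [multiE, hp]⟩
  have notD : ∀ m y k, U m y k → ¬ D m y := by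
    intro m y k hU hDy
    obtain ⟨n, h⟩ := pred m (pos m y k hU).1
    exact notMem h y k (pos m y k hU).2 hU (hD _ _ _ _ _ hDy)
  -- If `y` had two exceptional faces, each would be an ordinary face with respect to the other and
  -- so lie in `D`.
  have uniqueK : ∀ m y k k', U m y k → U m y k' → k = k' := by
    intro m y k k' hU hU'
    by_contra hne
    obtain ⟨n, h⟩ := pred m (pos m y k hU).1
    refine notMem h y k' (pos m y k' hU').2 hU' (mem m y k hU q h k' _ ?_)
    simpa using Ne.symm hne
  obtain ⟨g, hg⟩ := exists_of_rel (Y := Y) (X := X) (D := D')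
    (fun n y z => (∃ hy : D n y, f.app y hy = z) ∨ (∃ k, ∃ hU : U n y k, G n y k hU = z) ∨
      ∃ m, ∃ h : m = n + multiE q, ∃ y' k, ∃ hk : k ≤ m q, ∃ hU : U m y' k,
        Y.d q h k hk y' = y ∧ X.d q h k hk (G m y' k hU) = z)
    (by
      intro n y hy
      rcases cover n y hy with hy | ⟨k, hU⟩ | ⟨m, h, y', k, hk, hU, e⟩
      · exact ⟨_, Or.inl ⟨hy, rfl⟩⟩
      · exact ⟨_, Or.inr (Or.inl ⟨k, hU, rfl⟩)⟩
      · exact ⟨_, Or.inr (Or.inr ⟨m, h, y', k, hk, hU, e, rfl⟩)⟩)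
    (by
      rintro n y z z' (⟨hy, rfl⟩ | ⟨k, hU, rfl⟩ | ⟨m, h, y', k, hk, hU, e, rfl⟩)
        (⟨hy', rfl⟩ | ⟨k', hU', rfl⟩ | ⟨m', h', y'', k', hk', hU', e', rfl⟩)
      · rfl
      · exact absurd hy (notD _ _ _ hU')
      · exact absurd (e' ▸ hy) (notMem h' y'' k' hk' hU')
      · exact absurd hy' (notD _ _ _ hU)
      · obtain rfl := uniqueK _ _ _ _ hU hU'
        rfl
      · subst e'
        exact absurd hU (notU h' y'' k' hk' k hU')
      · exact absurd (e ▸ hy') (notMem h y' k hk hU)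
      · subst e
        exact absurd hU' (notU h y' k hk k' hU)
      · obtain rfl : m = m' := h.trans h'.symm
        obtain rfl := unique h y' y'' k k' hk hk' hU hU' (e.trans e'.symm)
        obtain rfl := uniqueK _ _ _ _ hU hU'
        rfl)
    (by
      rintro p m n h i hi y z (⟨hy, rfl⟩ | ⟨k, hU, rfl⟩ | ⟨m', h', y', k, hk, hU, rfl, rfl⟩)
      · exact Or.inl ⟨hD p h i hi y hy, (f.comm p h i hi y hy _).symm⟩
      · by_cases ne : (p, i) = (q, k)
        · obtain ⟨rfl, rfl⟩ := Prod.mk.inj ne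
          exact Or.inr (Or.inr ⟨m, h, y, i, hi, hU, rfl, rfl⟩)
        · exact Or.inl ⟨mem m y k hU p h i hi ne, (hG m y k hU p h i hi ne).symm⟩
      -- By the face identities, a face of the exceptional face of `y'` is also a face of another
      -- face of `y'`. That one lies in `D`, where the filler agrees with `f`.
      · left
        have hm' := apply_of_eq_add_multiE h'
        have hm := apply_of_eq_add_multiE h
        by_cases hpq : p = q
        · subst hpq
          have h1 := hm p
          have h2 := hm' p
          simp only [if_true] at h1 h2
          rcases lt_or_ge i k with hik | hik
          · have ne : (p, i) ≠ (p, k) := by simpa using hik.ne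
            have e := Y.d_d_same p h' h i k hik hk hi (by omega) (by omega) y'
            rw [X.d_d_same p h' h i k hik hk hi (by omega) (by omega), hG m' y' k hU p h' i _ ne]
            have hmem := hD p h (k - 1) (by omega) _ (mem m' y' k hU p h' i (by omega) ne)
            rw [f.comm p h _ _ _ _ hmem]
            exact ⟨e ▸ hmem, f.app_congr e _ _⟩
          · have ne : (p, i + 1) ≠ (p, k) := by simp; omega
            have e := Y.d_d_same p h' h k (i + 1) (by omega) (by omega) (by omega) hk hi y'
            simp only [Nat.add_sub_cancel] at e
            have e' := X.d_d_same p h' h k (i + 1) (by omega) (by omega) (by omega) hk hi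
              (G m' y' k hU)
            simp only [Nat.add_sub_cancel] at e'
            rw [← e', hG m' y' k hU p h' (i + 1) _ ne]
            have hmem := hD p h k (by omega) _ (mem m' y' k hU p h' (i + 1) (by omega) ne)
            rw [f.comm p h _ _ _ _ hmem]
            exact ⟨e ▸ hmem, f.app_congr e.symm _ _⟩
        · have ne : (p, i) ≠ (q, k) := fun e => hpq (Prod.mk.inj e).1
          have h1 : m' = (n + multiE q) + multiE p := by
            rw [h', h, add_assoc, add_assoc, add_comm (multiE p)]
          have b1 := apply_of_eq_add_multiE h' p
          have b2 := apply_of_eq_add_multiE h q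
          have b3 := apply_of_eq_add_multiE h' q
          have b4 : (n + multiE q) q = n q + 1 := by simp [multiE]
          simp only [hpq, Ne.symm hpq, if_true, if_false] at b1 b2 b3
          have e := Y.d_d_ne p q hpq h' h h1 rfl i k hk hi (by omega) (by omega) y'
          rw [X.d_d_ne p q hpq h' h h1 rfl i k hk hi (by omega) (by omega),
            hG m' y' k hU p h1 i _ ne]
          have hmem := hD q rfl k (by omega) _ (mem m' y' k hU p h1 i (by omega) ne)
          rw [f.comm q rfl _ _ _ _ hmem]
          exact ⟨e ▸ hmem, f.app_congr e _ _⟩)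
  exact ⟨g, fun n y hy hy' => hg n y hy' _ (Or.inl ⟨hy, rfl⟩)⟩

end PartialHom

/-! ### Monotone operators and the cosimplicial identities -/

/-- The families of monotone maps `{0, ..., n_p} → {0, ..., k_p}`. -/
abbrev MultiHom (n k : Fin l → ℕ) : Type := ∀ p, Fin (n p + 1) →o Fin (k p + 1)

namespace MultiHom

theorem ext_val {n k : Fin l → ℕ} {θ θ' : MultiHom n k}
    (h : ∀ p x, (θ p x : ℕ) = θ' p x) : θ = θ' := by
  funext p
  ext x
  exact h p x

/-- The identity. -/
def id (n : Fin l → ℕ) : MultiHom n n := fun _ => OrderHom.id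

/-- Composition. -/
def comp {n m k : Fin l → ℕ} (θ : MultiHom m k) (η : MultiHom n m) : MultiHom n k :=
  fun p => (θ p).comp (η p)

@[simp] theorem comp_apply {n m k : Fin l → ℕ} (θ : MultiHom m k) (η : MultiHom n m) (p x) :
    (θ.comp η) p x = θ p (η p x) := rfl

@[simp] theorem id_apply {n : Fin l → ℕ} (p x) : (MultiHom.id n) p x = x := rfl

@[simp] theorem id_comp {n k : Fin l → ℕ} (θ : MultiHom n k) : (MultiHom.id k).comp θ = θ := rfl

theorem comp_assoc {n m k j : Fin l → ℕ} (θ : MultiHom k j) (η : MultiHom m k)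
    (ζ : MultiHom n m) : (θ.comp η).comp ζ = θ.comp (η.comp ζ) := rfl

/-- The map that omits the value `i` in direction `p`. -/
def coface {p : Fin l} {m n : Fin l → ℕ} (h : m = n + multiE p) (i : ℕ) : MultiHom n m := fun q =>
  ⟨fun x => ⟨if q = p ∧ i ≤ x then x + 1 else x, by
      have := apply_of_eq_add_multiE h q
      have := x.2
      by_cases hq : q = p
      · simp only [hq, true_and, if_true] at *
        split_ifs <;> omega
      · simp only [hq, false_and, if_false] at *
        omega⟩, by
    intro x y hxy
    simp only [Fin.le_def] at hxy ⊢
    split_ifs <;> omega⟩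

/-- The map that takes the value `j` twice in direction `p`. -/
def codegeneracy {p : Fin l} {m n : Fin l → ℕ} (h : m = n + multiE p) (j : ℕ) : MultiHom m n :=
  fun q =>
  -- The `min` has an effect only in direction `p` when `j` exceeds `n p`. It keeps the map defined
  -- there, so that `j = a` is allowed below even when the missed value `a` is the top one.
  ⟨fun x => ⟨if q = p ∧ j < x then x - 1 else min x (n q), by
      have := apply_of_eq_add_multiE h q
      have := x.2
      split_ifs at * <;> simp_all⟩, by
    intro x y hxy
    have := apply_of_eq_add_multiE h q
    have := x.2
    have := y.2
    simp only [Fin.le_def] at hxy ⊢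
    by_cases hq : q = p
    · subst hq
      simp only [true_and, if_true] at *
      split_ifs <;> omega
    · simp only [hq, false_and, if_false]
      omega⟩

theorem coface_val {p : Fin l} {m n : Fin l → ℕ} (h : m = n + multiE p) (i : ℕ) (q) (x) :
    (coface h i q x : ℕ) = if q = p ∧ i ≤ x then (x : ℕ) + 1 else x := rfl

theorem codegeneracy_val {p : Fin l} {m n : Fin l → ℕ} (h : m = n + multiE p) (j : ℕ) (q) (x) :
    (codegeneracy h j q x : ℕ) = if q = p ∧ j < x then (x : ℕ) - 1 else min (x : ℕ) (n q) := rfl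

theorem coface_comp_coface_same {p : Fin l} {m n k : Fin l → ℕ} (hm : m = n + multiE p)
    (hn : n = k + multiE p) {i j : ℕ} (hij : i < j) :
    (coface hm j).comp (coface hn i) = (coface hm i).comp (coface hn (j - 1)) := by
  refine ext_val fun q x => ?_
  simp only [comp_apply, coface_val]
  by_cases hq : q = p <;> simp only [hq, true_and, false_and, if_false]
  split_ifs <;> omega

theorem coface_comp_coface_ne {p q : Fin l} (hpq : p ≠ q) {m n n' k : Fin l → ℕ}
    (hm : m = n + multiE q) (hn : n = k + multiE p) (hm' : m = n' + multiE p)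
    (hn' : n' = k + multiE q) (i j : ℕ) :
    (coface hm j).comp (coface hn i) = (coface hm' i).comp (coface hn' j) := by
  refine ext_val fun r x => ?_
  simp only [comp_apply, coface_val]
  by_cases hr : r = p
  · have : r ≠ q := fun e => hpq (hr.symm.trans e)
    simp [hr, hpq]
  · simp [hr]

theorem codegeneracy_comp_coface_lt {q : Fin l} {c n m : Fin l → ℕ} (hn : n = c + multiE q)
    (hm : m = n + multiE q) {i j : ℕ} (hij : i < j) (hj : j ≤ n q) :
    (codegeneracy hm j).comp (coface hm i) = (coface hn i).comp (codegeneracy hn (j - 1)) := by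
  refine ext_val fun r x => ?_
  have h1 := apply_of_eq_add_multiE hn r
  have h2 := x.2
  simp only [comp_apply, coface_val, codegeneracy_val]
  by_cases hr : r = q
  · subst hr
    simp only [true_and, if_true] at *
    split_ifs <;> omega
  · simp only [hr, false_and, if_false] at *
    omega

theorem codegeneracy_comp_coface_self {q : Fin l} {n m : Fin l → ℕ} (hm : m = n + multiE q)
    {i j : ℕ} (hij : i = j ∨ i = j + 1) :
    (codegeneracy hm j).comp (coface hm i) = MultiHom.id n := by
  refine ext_val fun r x => ?_
  have h2 := x.2
  simp only [comp_apply, coface_val, codegeneracy_val, id_apply]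
  by_cases hr : r = q
  · subst hr
    simp only [true_and] at *
    split_ifs <;> omega
  · simp only [hr, false_and, if_false] at *
    omega

theorem codegeneracy_comp_coface_gt {q : Fin l} {c n m : Fin l → ℕ} (hn : n = c + multiE q)
    (hm : m = n + multiE q) {i j : ℕ} (hij : j + 1 < i) (hi : i ≤ m q) :
    (codegeneracy hm j).comp (coface hm i) = (coface hn (i - 1)).comp (codegeneracy hn j) := by
  refine ext_val fun r x => ?_
  have h1 := apply_of_eq_add_multiE hn r
  have h3 := apply_of_eq_add_multiE hm r
  have h2 := x.2
  simp only [comp_apply, coface_val, codegeneracy_val]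
  by_cases hr : r = q
  · subst hr
    simp only [true_and, if_true] at *
    split_ifs <;> omega
  · simp only [hr, false_and, if_false] at *
    omega

theorem codegeneracy_comp_codegeneracy_same {q : Fin l} {n m k : Fin l → ℕ}
    (hm : m = n + multiE q) (hk : k = m + multiE q) {i j : ℕ} (hij : i < j) (hj : j ≤ m q) :
    (codegeneracy hm i).comp (codegeneracy hk j) =
      (codegeneracy hm (j - 1)).comp (codegeneracy hk i) := by
  refine ext_val fun r x => ?_
  have h1 := apply_of_eq_add_multiE hm r
  have h3 := apply_of_eq_add_multiE hk r
  have h2 := x.2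
  simp only [comp_apply, codegeneracy_val]
  by_cases hr : r = q
  · subst hr
    simp only [true_and, if_true] at *
    split_ifs <;> omega
  · simp only [hr, false_and, if_false] at *

theorem codegeneracy_comp_coface_ne {p q : Fin l} (hpq : p ≠ q) {n m c k : Fin l → ℕ}
    (hm : m = n + multiE q) (hm' : m = k + multiE p) (hn : n = c + multiE p)
    (hk : k = c + multiE q) (i j : ℕ) (hi : i ≤ n p) :
    (codegeneracy hm j).comp (coface hm' i) = (coface hn i).comp (codegeneracy hk j) := by
  refine ext_val fun r x => ?_
  have h1 := apply_of_eq_add_multiE hn r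
  have h3 := apply_of_eq_add_multiE hk r
  have h2 := x.2
  simp only [comp_apply, coface_val, codegeneracy_val]
  by_cases hr : r = q
  · subst hr
    simp only [true_and, if_true, Ne.symm hpq, false_and, if_false] at *
    split_ifs <;> omega
  · by_cases hr' : r = p
    · subst hr'
      simp only [true_and, if_true, hpq, false_and, if_false] at *
      split_ifs <;> omega
    · simp only [hr, hr', false_and, if_false] at *
      omega

theorem codegeneracy_comp_codegeneracy_ne {p q : Fin l} (hpq : p ≠ q) {n m m' k : Fin l → ℕ}
    (hm : m = n + multiE q) (hk : k = m + multiE p) (hm' : m' = n + multiE p)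
    (hk' : k = m' + multiE q) (i j : ℕ) :
    (codegeneracy hm j).comp (codegeneracy hk i) =
      (codegeneracy hm' i).comp (codegeneracy hk' j) := by
  refine ext_val fun r x => ?_
  have h1 := apply_of_eq_add_multiE hm r
  have h3 := apply_of_eq_add_multiE hk r
  have h4 := apply_of_eq_add_multiE hm' r
  have h2 := x.2
  simp only [comp_apply, codegeneracy_val]
  by_cases hr : r = q
  · subst hr
    simp only [true_and, if_true, Ne.symm hpq, false_and, if_false] at *
    split_ifs <;> omega
  · by_cases hr' : r = p
    · subst hr'
      simp only [true_and, if_true, hpq, false_and, if_false] at *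
      split_ifs <;> omega
    · simp only [hr, hr', false_and, if_false] at *
      omega

/-! ### Missed and repeated values, deletion and insertion -/

/-- All values are attained. -/
def Surj {n k : Fin l → ℕ} (θ : MultiHom n k) : Prop :=
  ∀ p (a : ℕ), a ≤ k p → ∃ x, (θ p x : ℕ) = a

/-- Only the values in `W` are attained more than once. -/
def InjOff (W : Set (Fin l × ℕ)) {n k : Fin l → ℕ} (θ : MultiHom n k) : Prop :=
  ∀ p x y, (θ p x : ℕ) = θ p y → x ≠ y → (p, (θ p x : ℕ)) ∈ W

/-- The value `a` in direction `p` is not attained. -/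
def Misses {n k : Fin l → ℕ} (θ : MultiHom n k) (p : Fin l) (a : ℕ) : Prop :=
  ∀ x, (θ p x : ℕ) ≠ a

theorem Misses.comp {n m k : Fin l → ℕ} {θ : MultiHom m k} {p : Fin l} {a : ℕ}
    (h : θ.Misses p a) (η : MultiHom n m) : (θ.comp η).Misses p a :=
  fun x => h (η p x)

theorem Surj.of_comp {n m k : Fin l → ℕ} {θ : MultiHom m k} {η : MultiHom n m}
    (h : (θ.comp η).Surj) : θ.Surj := fun p a ha =>
  let ⟨x, hx⟩ := h p a ha
  ⟨η p x, hx⟩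

theorem misses_of_not_surj {n k : Fin l → ℕ} {θ : MultiHom n k} (h : ¬ θ.Surj) :
    ∃ p a, a ≤ k p ∧ θ.Misses p a := by
  simpa only [Surj, Misses, not_forall, not_exists, exists_prop] using h

theorem Misses.not_surj {n k : Fin l → ℕ} {θ : MultiHom n k} {p : Fin l} {a : ℕ}
    (h : θ.Misses p a) (ha : a ≤ k p) : ¬ θ.Surj := fun hs =>
  let ⟨x, hx⟩ := hs p a ha
  h x hx

theorem coface_injective {p : Fin l} {m n : Fin l → ℕ} (h : m = n + multiE p) (i : ℕ) (q) :
    Function.Injective (coface h i q) := by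
  intro x y hxy
  have := congrArg Fin.val hxy
  simp only [coface_val] at this
  apply Fin.ext
  split_ifs at this <;> omega

theorem InjOff.comp_coface {W : Set (Fin l × ℕ)} {k m n : Fin l → ℕ} {θ : MultiHom m k}
    (hθ : θ.InjOff W) {p : Fin l} (h : m = n + multiE p) (i : ℕ) :
    (θ.comp (coface h i)).InjOff W := fun q _ _ hxy hne =>
  hθ q _ _ hxy (fun e => hne (coface_injective h i q e))

theorem coface_misses {p : Fin l} {m n : Fin l → ℕ} (h : m = n + multiE p) (i : ℕ) :
    (coface h i).Misses p i := by
  intro x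
  rw [coface_val]
  split_ifs <;> simp_all <;> omega

theorem exists_coface_eq {p : Fin l} {m n : Fin l → ℕ} (h : m = n + multiE p) (i : ℕ)
    (hi : i ≤ m p) (q) (x : Fin (m q + 1)) (hx : ¬ (q = p ∧ (x : ℕ) = i)) :
    ∃ y, coface h i q y = x := by
  have h1 := apply_of_eq_add_multiE h q
  have h2 := x.2
  by_cases hq : q = p
  · subst hq
    simp only [if_true, true_and] at h1 hx
    rcases lt_or_ge (x : ℕ) i with hlt | hge
    · refine ⟨⟨x, by omega⟩, Fin.ext ?_⟩
      simp [coface_val]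
      omega
    · refine ⟨⟨x - 1, by omega⟩, Fin.ext ?_⟩
      simp only [coface_val, true_and]
      split_ifs <;> omega
  · simp only [hq, if_false] at h1
    refine ⟨⟨x, by omega⟩, Fin.ext ?_⟩
    simp [coface_val, hq]

/-- A map that misses a value factors through the corresponding coface. -/
theorem coface_comp_codegeneracy_comp {p : Fin l} {m n c : Fin l → ℕ} (h : m = n + multiE p)
    {a j : ℕ} (ha : a ≤ m p) (haj : j = a ∨ j = a - 1) {θ : MultiHom c m} (hθ : θ.Misses p a) :
    (coface h a).comp ((codegeneracy h j).comp θ) = θ := by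
  refine ext_val fun q x => ?_
  have h1 := apply_of_eq_add_multiE h q
  have h2 := (θ q x).2
  simp only [comp_apply, coface_val, codegeneracy_val]
  by_cases hq : q = p
  · subst hq
    have h3 := hθ x
    simp only [if_true, true_and] at *
    split_ifs <;> omega
  · simp only [hq, if_false, false_and] at *
    omega

theorem exists_pred {m : Fin l → ℕ} {p : Fin l} (hm : 1 ≤ m p) : ∃ n, m = n + multiE p := by
  refine ⟨m - multiE p, ?_⟩
  funext q
  by_cases hq : q = p
  · subst hq
    simp [multiE]
    omega
  · simp [multiE, hq]

theorem Misses.exists_factor {n k : Fin l → ℕ} {θ : MultiHom n k} {p : Fin l} {a : ℕ}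
    (hθ : θ.Misses p a) (ha : a ≤ k p) :
    ∃ c, ∃ h : k = c + multiE p, ∃ θ' : MultiHom n c, (coface h a).comp θ' = θ := by
  have hk : 1 ≤ k p := by
    by_contra hk
    have h0 := hθ 0
    have := (θ p 0).2
    omega
  obtain ⟨c, h⟩ := exists_pred hk
  exact ⟨c, h, _, coface_comp_codegeneracy_comp h ha (Or.inl rfl) hθ⟩

theorem comp_coface_cancel {p : Fin l} {m n c : Fin l → ℕ} (h : m = n + multiE p) (a : ℕ)
    {θ θ' : MultiHom c n} (e : (coface h a).comp θ = (coface h a).comp θ') : θ = θ' := by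
  funext q
  ext x
  exact congrArg Fin.val (coface_injective h a q (DFunLike.congr_fun (congrFun e q) x))

/-- Inserting a missed value. -/
theorem Misses.exists_insert {n k : Fin l → ℕ} {θ : MultiHom n k} {q : Fin l} {w : ℕ}
    (hθ : θ.Misses q w) (hw : w ≤ k q) {m : Fin l → ℕ} (h : m = n + multiE q) :
    ∃ (τ : MultiHom m k) (a : Fin (m q + 1)), (τ q a : ℕ) = w ∧ τ.comp (coface h a) = θ := by
  classical
  have hm := apply_of_eq_add_multiE h
  have hq : m q = n q + 1 := by simpa using hm q
  -- The new entry goes in at the first position from which all values exceed `w`, or at the end if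
  -- there is none.
  have hex : ∃ a : ℕ, ∀ x : Fin (n q + 1), a ≤ x → w < θ q x := ⟨n q + 1, fun x hx => by omega⟩
  let a := Nat.find hex
  have ha : ∀ x : Fin (n q + 1), a ≤ x → w < θ q x := Nat.find_spec hex
  have ha' : ∀ x : Fin (n q + 1), (x : ℕ) < a → (θ q x : ℕ) < w := by
    intro x hx
    have := Nat.find_min hex hx
    push Not at this
    obtain ⟨y, hxy, hy⟩ := this
    have h1 : (θ q x : ℕ) ≤ θ q y := (θ q).monotone hxy
    have h2 := hθ x
    omega
  have han : a ≤ n q + 1 := Nat.find_min' hex fun x hx => by omega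
  -- For `a = 0` the truncated `a - 1` is `0`, and the codegeneracy at `0` still retracts the coface
  -- at `0`.
  let ρ := codegeneracy h (a - 1)
  have hρ : ρ.comp (coface h a) = MultiHom.id n := codegeneracy_comp_coface_self h (by omega)
  let τ : MultiHom m k := fun p =>
    -- The branch is taken only for `p = q`, where `min w (k p)` is `w`; the `min` supplies the
    -- bound for arbitrary `p`.
    ⟨fun x => if p = q ∧ (x : ℕ) = a then ⟨min w (k p), by omega⟩ else θ p (ρ p x), by
      intro x y hxy
      have hmono : θ p (ρ p x) ≤ θ p (ρ p y) := (θ p).monotone ((ρ p).monotone hxy)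
      by_cases hp : p = q
      · subst hp
        simp only [true_and]
        have hx : (ρ p x : ℕ) = _ := codegeneracy_val h _ p x
        have hy : (ρ p y : ℕ) = _ := codegeneracy_val h _ p y
        have h3 := x.2
        have h4 := y.2
        simp only [true_and] at hx hy
        rw [Fin.le_def] at hxy
        split_ifs with h1 h2 h2
        · exact le_rfl
        · have : w < θ p (ρ p y) := ha _ (by rw [hy]; split_ifs <;> omega)
          rw [Fin.le_def]
          simp only
          omega
        · have : (θ p (ρ p x) : ℕ) < w := ha' _ (by rw [hx]; split_ifs <;> omega)
          rw [Fin.le_def]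
          simp only
          omega
        · exact hmono
      · simpa [hp] using hmono⟩
  refine ⟨τ, ⟨a, by omega⟩, ?_, ?_⟩
  · simp [τ, hw]
  · refine ext_val fun p x => ?_
    have h1 : ρ p (coface h a p x) = x := DFunLike.congr_fun (congrFun hρ p) x
    have h2 : ¬ (p = q ∧ (coface h a p x : ℕ) = a) := by
      rintro ⟨rfl, e⟩
      exact coface_misses h a x e
    change ((if p = q ∧ (coface h a p x : ℕ) = a then _ else θ p (ρ p (coface h a p x)) :
      Fin (k p + 1)) : ℕ) = _
    rw [if_neg h2, h1]

/-- A map is determined by what is left after removing the only occurrence of a value. -/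
theorem insert_unique {n m k : Fin l → ℕ} {q : Fin l} {w : ℕ} (h : m = n + multiE q)
    {τ τ' : MultiHom m k} {a a' : Fin (m q + 1)} (ha : (τ q a : ℕ) = w) (ha' : (τ' q a' : ℕ) = w)
    (hmiss : (τ.comp (coface h a)).Misses q w) (e : τ.comp (coface h a) = τ'.comp (coface h a')) :
    τ = τ' := by
  wlog hle : a ≤ a' generalizing τ τ' a a'
  · exact (this ha' ha (e ▸ hmiss) e.symm (le_of_not_ge hle)).symm
  have ev : ∀ p x, τ p (coface h a p x) = τ' p (coface h a' p x) := fun p x =>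
    DFunLike.congr_fun (congrFun e p) x
  have hq : m q = n q + 1 := by simpa using apply_of_eq_add_multiE h q
  have haa : a = a' := by
    by_contra hne
    have hlt : (a : ℕ) < a' := lt_of_le_of_ne hle (fun e => hne (Fin.ext e))
    -- If `a < a'`, deleting `a` moves a value at least `w` to position `a`, while deleting `a'`
    -- leaves there a value at most `w`. The common value would be `w`, which is missed.
    let x : Fin (n q + 1) := ⟨a, by omega⟩
    have h1 := ev q x
    have h2 : a ≤ coface h a q x := by
      rw [Fin.le_def, coface_val]
      simp [x]
    have h3 : coface h a' q x ≤ a' := by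
      rw [Fin.le_def, coface_val]
      simp [x]
      split_ifs <;> omega
    have h4 : (τ q a : ℕ) ≤ τ q (coface h a q x) := (τ q).monotone h2
    have h5 : (τ' q (coface h a' q x) : ℕ) ≤ τ' q a' := (τ' q).monotone h3
    refine hmiss x ?_
    rw [comp_apply]
    rw [← h1] at h5
    omega
  subst haa
  refine ext_val fun p x => ?_
  by_cases hx : p = q ∧ (x : ℕ) = a
  · obtain ⟨rfl, hx⟩ := hx
    rw [Fin.ext hx, ha, ha']
  · obtain ⟨y, rfl⟩ := exists_coface_eq h a (by omega) p x hx
    exact congrArg Fin.val (ev p y)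

theorem InjOff.insert {n m k : Fin l → ℕ} {q : Fin l} {w : ℕ} (h : m = n + multiE q)
    {W : Set (Fin l × ℕ)} {τ : MultiHom m k} {a : Fin (m q + 1)} (ha : (τ q a : ℕ) = w)
    (hmiss : (τ.comp (coface h a)).Misses q w) (hW : (τ.comp (coface h a)).InjOff W) :
    τ.InjOff W := by
  have key : ∀ p (x : Fin (m p + 1)), (p = q ∧ (x : ℕ) = a) ∨ ∃ y, coface h a p y = x := fun p x =>
    or_iff_not_imp_left.2 (exists_coface_eq h a (by omega) p x)
  intro p x y hxy hne
  rcases key p x with ⟨rfl, hx⟩ | ⟨x', rfl⟩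
  · rcases key p y with ⟨-, hy⟩ | ⟨y', rfl⟩
    · exact absurd (Fin.ext (hx.trans hy.symm)) hne
    · rw [Fin.ext hx, ha] at hxy
      exact absurd hxy.symm (hmiss y')
  · rcases key p y with ⟨rfl, hy⟩ | ⟨y', rfl⟩
    · rw [Fin.ext hy, ha] at hxy
      exact absurd hxy (hmiss x')
    · exact hW p x' y' hxy (fun e => hne (congrArg _ e))

theorem InjOff.misses {m n k : Fin l → ℕ} {W : Set (Fin l × ℕ)} {τ : MultiHom m k}
    (hτ : τ.InjOff W) {q : Fin l} (h : m = n + multiE q) (a : Fin (m q + 1))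
    (hW : (q, (τ q a : ℕ)) ∉ W) : (τ.comp (coface h a)).Misses q (τ q a) := by
  intro x hx
  refine hW (hτ q a (coface h a q x) hx.symm ?_)
  intro e
  exact coface_misses h a x (congrArg Fin.val e).symm

end MultiHom

/-! ### Extension over a standard multisimplex by doubling vertices -/

/-- The multisemisimplicial set of all multisimplices, degenerate ones included, of the standard
multisimplex of multi-index `k`. -/
def standard (k : Fin l → ℕ) : MultiSemiSimplicialSet.{0} l where
  obj n := MultiHom n k
  d _ _ _ h i _ θ := θ.comp (MultiHom.coface h i)
  d_d_same _ _ _ _ hm hn _ _ hij _ _ _ _ θ :=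
    congrArg θ.comp (MultiHom.coface_comp_coface_same hm hn hij)
  d_d_ne _ _ hpq _ _ _ _ hm hn hm' hn' i j _ _ _ _ θ :=
    congrArg θ.comp (MultiHom.coface_comp_coface_ne hpq hm hn hm' hn' i j)

/-- Partial maps can be pulled back along operators between standard multisimplices. -/
def PartialHom.pullback {X : MultiSemiSimplicialSet.{u} l} {k m : Fin l → ℕ}
    {D : ∀ n, MultiHom n m → Prop} (f : PartialHom (standard m) X D) (ρ : MultiHom k m)
    {D' : ∀ n, MultiHom n k → Prop} (hD : ∀ n (θ : MultiHom n k), D' n θ → D n (ρ.comp θ)) :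
    PartialHom (standard k) X D' where
  app θ hθ := f.app (ρ.comp θ) (hD _ θ hθ)
  comm p _ _ h i hi θ hθ hθ' :=
    f.comm p h i hi (ρ.comp θ) (hD _ θ hθ) (hD _ _ hθ')

/-- The total degree of a multi-index. -/
def size (n : Fin l → ℕ) : ℕ := ∑ p, n p

theorem size_of_eq_add_multiE {p : Fin l} {m n : Fin l → ℕ} (h : m = n + multiE p) :
    size m = size n + 1 := by
  subst h
  simp [size, Finset.sum_add_distrib, multiE]

namespace MultiHom

theorem codegeneracy_val_eq {q : Fin l} {m n : Fin l → ℕ} (h : m = n + multiE q) {t : ℕ}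
    (ht : t ≤ n q) {p} {x y : Fin (m p + 1)}
    (e : (codegeneracy h t p x : ℕ) = codegeneracy h t p y) :
    x = y ∨ p = q ∧ ((x : ℕ) = t ∧ (y : ℕ) = t + 1 ∨ (x : ℕ) = t + 1 ∧ (y : ℕ) = t) := by
  have h1 := apply_of_eq_add_multiE h p
  have h2 := x.2
  have h3 := y.2
  simp only [codegeneracy_val] at e
  rw [Fin.ext_iff]
  by_cases hp : p = q
  · subst hp
    simp only [true_and, if_true] at *
    split_ifs at e <;> omega
  · simp only [hp, false_and, if_false] at *
    omega

theorem codegeneracy_val_eq_of {q : Fin l} {m n : Fin l → ℕ} (h : m = n + multiE q) {t : ℕ}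
    {x y : Fin (m q + 1)} (hx : (x : ℕ) = t) (hy : (y : ℕ) = t + 1) :
    (codegeneracy h t q x : ℕ) = codegeneracy h t q y := by
  have h1 := apply_of_eq_add_multiE h q
  have h3 := y.2
  simp only [codegeneracy_val, true_and, if_true] at *
  split_ifs <;> omega

/-- The only fibre of the codegeneracy with more than one element is `{t, t + 1}` in direction `q`,
so any other missed value stays missed. -/
theorem Misses.not_surj_codegeneracy_comp {q : Fin l} {K k n : Fin l → ℕ} (h : K = k + multiE q)
    {t : ℕ} (ht : t ≤ k q) {τ : MultiHom n K} {p : Fin l} {a : ℕ} (hτ : τ.Misses p a) (ha : a ≤ K p)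
    (hne : ¬ (p = q ∧ (a = t ∨ a = t + 1))) : ¬ ((codegeneracy h t).comp τ).Surj := by
  intro hs
  let v : Fin (K p + 1) := ⟨a, by omega⟩
  obtain ⟨x, hx⟩ := hs p (codegeneracy h t p v) (by omega)
  rcases codegeneracy_val_eq h ht hx with e | ⟨hp, e⟩
  · exact hτ x (congrArg Fin.val e)
  · exact hne ⟨hp, by simp only [v] at e; omega⟩

theorem Surj.comp_coface {k m n : Fin l → ℕ} {θ : MultiHom m k} (hθ : θ.Surj) {q : Fin l}
    (h : m = n + multiE q) (a x : Fin (m q + 1)) (hx : x ≠ a) (e : (θ q x : ℕ) = θ q a) :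
    (θ.comp (coface h a)).Surj := by
  intro p b hb
  obtain ⟨y, rfl⟩ := hθ p b hb
  by_cases hy : p = q ∧ (y : ℕ) = a
  · obtain ⟨rfl, hy⟩ := hy
    obtain ⟨x', rfl⟩ := exists_coface_eq h a (by omega) p x (fun e => hx (Fin.ext e.2))
    exact ⟨x', by rw [comp_apply, e, Fin.ext hy]⟩
  · obtain ⟨y', rfl⟩ := exists_coface_eq h a (by omega) p y hy
    exact ⟨y', rfl⟩

/-- The maps that are not surjective, or repeat at most the values in `W`. -/
def Tame (W : Set (Fin l × ℕ)) {k : Fin l → ℕ} (n : Fin l → ℕ) (θ : MultiHom n k) : Prop :=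
  ¬ θ.Surj ∨ θ.InjOff W

/-- The maps to `k + e_q` that are not surjective after identifying the values `t` and `t + 1`
in direction `q`, or are injective. -/
def Doubled {q : Fin l} {K k : Fin l → ℕ} (h : K = k + multiE q) (t : ℕ) (n : Fin l → ℕ)
    (τ : MultiHom n K) : Prop :=
  ¬ ((codegeneracy h t).comp τ).Surj ∨ τ.InjOff ∅

theorem Doubled.faceClosed {q : Fin l} {K k : Fin l → ℕ} (h : K = k + multiE q) (t : ℕ) :
    FaceClosed (standard K) (Doubled h t) := by
  intro p m n h' i hi τ hτ
  exact hτ.imp (fun hs hs' => hs (Surj.of_comp hs')) (fun hi => hi.comp_coface h' i)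

/-- The codegeneracy creates a repetition only by identifying `t` with `t + 1`, which cannot happen
if one of them is missed. -/
theorem InjOff.codegeneracy_comp {q : Fin l} {K k n : Fin l → ℕ} (h : K = k + multiE q)
    {t : ℕ} (ht : t ≤ k q) {τ : MultiHom n K} {V W : Set (Fin l × ℕ)} (hτ : τ.InjOff V)
    (hmiss : τ.Misses q t ∨ τ.Misses q (t + 1))
    (hVW : ∀ p x, (p, (τ p x : ℕ)) ∈ V → (p, (codegeneracy h t p (τ p x) : ℕ)) ∈ W) :
    ((codegeneracy h t).comp τ).InjOff W := by
  intro p x y hxy hne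
  rcases codegeneracy_val_eq h ht hxy with e | ⟨rfl, e⟩
  · exact hVW p x (hτ p x y (congrArg Fin.val e) hne)
  · exfalso
    rcases hmiss with hm | hm
    · have := hm x
      have := hm y
      omega
    · have := hm x
      have := hm y
      omega

end MultiHom

open MultiHom

/-- Filling a horn on the standard multisimplex with the vertex `t` in direction `q` doubled. -/
theorem exists_extend_doubled {X : MultiSemiSimplicialSet.{u} l} (hX : X.IsKan) {q : Fin l}
    {K k : Fin l → ℕ} (h : K = k + multiE q) {t : ℕ} (ht : t ≤ k q)
    (f : PartialHom (standard k) X (Tame ∅)) :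
    ∃ g : PartialHom (standard K) X (Doubled h t),
      ∀ n (θ : MultiHom n k) (hθ : Tame ∅ n θ)
        (hθ' : Doubled h t n ((coface h (t + 1)).comp θ)),
        g.app ((coface h (t + 1)).comp θ) hθ' = f.app θ hθ := by
  have hKq : K q = k q + 1 := by simpa using apply_of_eq_add_multiE h q
  -- On `D` the extension is forced to be `f` after the codegeneracy; this already covers the face
  -- omitting `t + 1`.
  let D : ∀ n, MultiHom n K → Prop := fun n τ =>
    ¬ ((codegeneracy h t).comp τ).Surj ∨ (τ.InjOff ∅ ∧ τ.Misses q (t + 1))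
  have hD : FaceClosed (standard K) D := by
    intro p m n h' i hi τ hτ
    exact hτ.imp (fun hs hs' => hs (Surj.of_comp hs'))
      (fun hi => ⟨hi.1.comp_coface h' i, hi.2.comp _⟩)
  have hDT : ∀ n (τ : MultiHom n K), D n τ → Tame ∅ n ((codegeneracy h t).comp τ) :=
    fun n τ hτ => hτ.imp (fun hs => hs)
      (fun hi => hi.1.codegeneracy_comp h ht (Or.inr hi.2) (fun _ _ hx => hx.elim))
  -- An injective and surjective `τ` can only be the identity of `K`, so a single horn is filled.
  -- Its missing face omits `t`.
  let U : ∀ m, MultiHom m K → ℕ → Prop := fun m τ a =>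
    τ.InjOff ∅ ∧ τ.Surj ∧ ∃ ha : a < m q + 1, (τ q ⟨a, ha⟩ : ℕ) = t
  have hmiss : ∀ {m n} (h' : m = n + multiE q) (τ : MultiHom m K) a, U m τ a →
      (τ.comp (coface h' a)).Misses q t := by
    rintro m n h' τ a ⟨hinj, -, ha, hat⟩
    have := hinj.misses h' ⟨a, ha⟩ (fun h => h)
    rwa [hat] at this
  obtain ⟨g, hg⟩ := PartialHom.exists_attach hX hD (f.pullback (codegeneracy h t) hDT) q U
    (D' := Doubled h t)
    (by
      rintro m τ a ⟨-, hs, ha, hat⟩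
      obtain ⟨x, hx⟩ := hs q (t + 1) (by omega)
      have : (x : ℕ) ≠ a := by
        intro e
        have : x = ⟨a, ha⟩ := Fin.ext e
        subst this
        omega
      omega)
    (by
      rintro m n h' τ a ha' ⟨hinj, hs, ha, hat⟩
      obtain ⟨x, hx⟩ := hs q (t + 1) (by omega)
      have hxa : x ≠ ⟨a, ha⟩ := by
        rintro rfl
        omega
      rintro (hns | ⟨-, hm⟩)
      · refine hns (Surj.comp_coface (θ := (codegeneracy h t).comp τ) ?_ h' ⟨a, ha⟩ x hxa
          (codegeneracy_val_eq_of h hat hx).symm)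
        intro p b hb
        have hr : ((codegeneracy h t).comp (coface h t)) p ⟨b, by omega⟩ = _ :=
          DFunLike.congr_fun
            (congrFun (codegeneracy_comp_coface_self h (Or.inl rfl)) p) ⟨b, by omega⟩
        obtain ⟨y, hy⟩ := hs p (coface h t p ⟨b, by omega⟩) (by omega)
        exact ⟨y, (congrArg (fun v => (codegeneracy h t p v : ℕ)) (Fin.ext hy)).trans
          (congrArg Fin.val hr)⟩
      · obtain ⟨x', rfl⟩ := exists_coface_eq h' a ha' q x (fun e => hxa (Fin.ext e.2))
        exact hm x' hx)
    (by
      rintro m n h' τ a ha' a' hU ⟨-, hs, -⟩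
      exact (hmiss h' τ a hU).not_surj (by omega) hs)
    (by
      rintro m τ a ⟨hinj, hs, ha, hat⟩ p n h' i hi hne
      have hm := hinj.misses h' ⟨i, by omega⟩ (fun h => h)
      -- The face omitting `t + 1` is injective and misses `t + 1`. A face omitting any value other
      -- than `t` and `t + 1` is not surjective after the codegeneracy.
      by_cases hv : p = q ∧ (τ p ⟨i, by omega⟩ : ℕ) = t + 1
      · obtain ⟨rfl, hv⟩ := hv
        rw [hv] at hm
        exact Or.inr ⟨hinj.comp_coface h' i, hm⟩
      · refine Or.inl (hm.not_surj_codegeneracy_comp h ht (by omega) ?_)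
        rintro ⟨rfl, e | e⟩
        · refine hinj p ⟨i, by omega⟩ ⟨a, ha⟩ (e.trans hat.symm) ?_
          intro e'
          have e'' : i = a := congrArg Fin.val e'
          exact hne (by rw [e''])
        · exact hv ⟨rfl, e⟩)
    (by
      rintro m n h' τ τ' a a' ha ha' hU hU' e
      exact insert_unique h' hU.2.2.2 hU'.2.2.2 (hmiss h' τ a hU) e)
    (by
      rintro n τ (hτ | hτ)
      · exact Or.inl (Or.inl hτ)
      by_cases hm : τ.Misses q (t + 1)
      · exact Or.inl (Or.inr ⟨hτ, hm⟩)
      by_cases hs : ((codegeneracy h t).comp τ).Surj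
      swap
      · exact Or.inl (Or.inl hs)
      have hit : ∀ p b, b ≤ K p → ¬ (p = q ∧ b = t) → ∃ x, (τ p x : ℕ) = b := by
        intro p b hb hne
        by_contra hcon
        have hmb : τ.Misses p b := fun x hx => hcon ⟨x, hx⟩
        refine hmb.not_surj_codegeneracy_comp h ht hb ?_ hs
        rintro ⟨rfl, rfl | rfl⟩
        · exact hne ⟨rfl, rfl⟩
        · exact hm hmb
      by_cases hm' : τ.Misses q t
      · obtain ⟨τ', a, hat, hτ'⟩ := hm'.exists_insert (by omega) (rfl : n + multiE q = _)
        refine Or.inr (Or.inr ⟨_, rfl, τ', a, by omega, ⟨?_, ?_, a.2, hat⟩, hτ'⟩)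
        · exact InjOff.insert rfl hat (by rwa [hτ']) (by rwa [hτ'])
        · intro p b hb
          by_cases hpb : p = q ∧ b = t
          · obtain ⟨rfl, rfl⟩ := hpb
            exact ⟨a, hat⟩
          · obtain ⟨x, hx⟩ := hit p b hb hpb
            rw [← hτ'] at hx
            exact ⟨_, hx⟩
      · have hs' : τ.Surj := by
          intro p b hb
          by_cases hpb : p = q ∧ b = t
          · obtain ⟨rfl, rfl⟩ := hpb
            by_contra hcon
            exact hm' (fun x hx => hcon ⟨x, hx⟩)
          · exact hit p b hb hpb
        obtain ⟨x, hx⟩ := hs' q t (by omega)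
        exact Or.inr (Or.inl ⟨x, hτ, hs', x.2, hx⟩))
  refine ⟨g, fun n θ hθ hθ' => ?_⟩
  have hσδ := codegeneracy_comp_coface_self (n := k) h (i := t + 1) (j := t) (Or.inr rfl)
  have hσ : (codegeneracy h t).comp ((coface h (t + 1)).comp θ) = θ := by
    rw [← comp_assoc, hσδ, id_comp]
  have hDθ : D n ((coface h (t + 1)).comp θ) := by
    rcases hθ with hs | hi
    · exact Or.inl (by rwa [hσ])
    · refine Or.inr ⟨?_, (coface_misses h _).comp θ⟩
      intro p x y hxy hne
      exact (hi p x y (congrArg Fin.val (coface_injective h _ p (Fin.ext hxy))) hne).elim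
  rw [hg n _ hDθ hθ']
  exact f.app_congr hσ _ _

namespace MultiHom

/-- The values of a map to `k + e_q` that lie over `(q, t)` or `W` after identifying `t` and `t + 1`
in direction `q`, other than `t + 1` itself. -/
def overInsert {q : Fin l} {K k : Fin l → ℕ} (h : K = k + multiE q) (t : ℕ)
    (W : Set (Fin l × ℕ)) : Set (Fin l × ℕ) :=
  {v | v ≠ (q, t + 1) ∧ ∃ a : Fin (K v.1 + 1), (a : ℕ) = v.2 ∧
    (v.1, (codegeneracy h t v.1 a : ℕ)) ∈ insert (q, t) W}

/-- The maps to `k + e_q` that are `Doubled`, or miss `t` in direction `q` and repeat at most the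
values in `W`. -/
def DoubledTame {q : Fin l} {K k : Fin l → ℕ} (h : K = k + multiE q) (t : ℕ) (W : Set (Fin l × ℕ))
    (n : Fin l → ℕ) (τ : MultiHom n K) : Prop :=
  Doubled h t n τ ∨ (τ.Misses q t ∧ Tame W n ((codegeneracy h t).comp τ))

theorem Tame.faceClosed (W : Set (Fin l × ℕ)) (k : Fin l → ℕ) :
    FaceClosed (standard k) (Tame W) := by
  intro p m n h' i hi τ hτ
  exact hτ.imp (fun hs hs' => hs hs'.of_comp) (fun hi => hi.comp_coface h' i)

theorem missesTame_faceClosed {q : Fin l} {K k : Fin l → ℕ} (h : K = k + multiE q) (t : ℕ)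
    (W : Set (Fin l × ℕ)) : FaceClosed (standard K)
      (fun n (τ : MultiHom n K) => τ.Misses q t ∧ Tame W n ((codegeneracy h t).comp τ)) := by
  intro p m n h' i hi τ hτ
  exact ⟨hτ.1.comp _, Tame.faceClosed W k p h' i hi _ hτ.2⟩

theorem DoubledTame.faceClosed {q : Fin l} {K k : Fin l → ℕ} (h : K = k + multiE q) (t : ℕ)
    (W : Set (Fin l × ℕ)) : FaceClosed (standard K) (DoubledTame h t W) := by
  intro p m n h' i hi τ hτ
  exact hτ.imp (Doubled.faceClosed h t p h' i hi τ) (missesTame_faceClosed h t W p h' i hi τ)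

/-- If `t` is missed, then identifying `t` with the unrepeated `t + 1` leaves only repetitions in
`W`, so the map is already covered. Hence the maps still to be treated attain `t`, and deleting `t +
1` from them preserves surjectivity after the codegeneracy. -/
theorem not_misses_of_not_doubledTame {q : Fin l} {K k : Fin l → ℕ} (h : K = k + multiE q) {t : ℕ}
    (ht : t ≤ k q) {W : Set (Fin l × ℕ)} {n : Fin l → ℕ} {τ : MultiHom n K}
    (hτ : ¬ DoubledTame h t W n τ) (hinj : τ.InjOff (overInsert h t W)) : ¬ τ.Misses q t := by
  intro hm
  refine hτ (Or.inr ⟨hm, Or.inr (hinj.codegeneracy_comp h ht (Or.inl hm) ?_)⟩)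
  have hKq : K q = k q + 1 := by simpa using apply_of_eq_add_multiE h q
  have fiber : ∀ v : Fin (K q + 1), (codegeneracy h t q v : ℕ) = t →
      (v : ℕ) = t ∨ (v : ℕ) = t + 1 := by
    intro v hv
    have := v.2
    simp only [codegeneracy_val, true_and] at hv
    split_ifs at hv <;> omega
  rintro p x ⟨hne, a, ha, hmem⟩
  obtain rfl : a = τ p x := Fin.ext ha
  rcases hmem with e | hmem
  · obtain ⟨rfl, e⟩ := Prod.mk.inj e
    rcases fiber (τ p x) e with e | e
    · exact (hm x e).elim
    · exact (hne (by rw [e])).elim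
  · exact hmem

end MultiHom

/-- The new simplices come in pairs: one attaining `t + 1`, necessarily once, and its face with that
entry deleted. Every other face of the first still attains `t + 1` and has smaller degree. Treating
the pairs by increasing degree therefore presents each first member as a horn whose missing face is
the second. -/
theorem exists_extend_iterated {X : MultiSemiSimplicialSet.{u} l} (hX : X.IsKan) {q : Fin l}
    {K k : Fin l → ℕ} (h : K = k + multiE q) {t : ℕ} (ht : t ≤ k q) (W : Set (Fin l × ℕ))
    (f : PartialHom (standard K) X (DoubledTame h t W)) :
    ∃ g : PartialHom (standard K) X
        (fun n τ => DoubledTame h t W n τ ∨ InjOff (overInsert h t W) τ),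
      ∀ n τ (hτ : DoubledTame h t W n τ), g.app τ (Or.inl hτ) = f.app τ hτ := by
  have hKq : K q = k q + 1 := by simpa using apply_of_eq_add_multiE h q
  -- The bound is stricter by one for simplices missing `t + 1`, so that they enter together with
  -- their partners of one degree more.
  let D : ℕ → ∀ n, MultiHom n K → Prop := fun N n τ =>
    DoubledTame h t W n τ ∨ (InjOff (overInsert h t W) τ ∧ size n < N ∧
      (τ.Misses q (t + 1) → size n + 1 < N))
  have hw : (q, t + 1) ∉ overInsert h t W := fun hw => hw.1 rfl
  have hD : ∀ N, FaceClosed (standard K) (D N) := by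
    intro N p m n h' i hi τ hτ
    have := size_of_eq_add_multiE h'
    refine hτ.imp (DoubledTame.faceClosed h t W p h' i hi τ) fun hτ =>
      ⟨hτ.1.comp_coface h' i, by omega, fun _ => by omega⟩
  have zero : ∀ n τ, D 0 n τ → DoubledTame h t W n τ := by
    rintro n τ (hτ | hτ)
    · exact hτ
    · omega
  obtain ⟨g, hg⟩ := PartialHom.exists_extend_iUnion D hD
    (fun N n τ hτ => hτ.imp_right fun hτ => ⟨hτ.1, by omega, fun hm => by have := hτ.2.2 hm; omega⟩)
    (by
      intro N f'
      let U : ∀ m, MultiHom m K → ℕ → Prop := fun m τ a =>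
        ¬ DoubledTame h t W m τ ∧ InjOff (overInsert h t W) τ ∧ size m = N ∧
          ∃ ha : a < m q + 1, (τ q ⟨a, ha⟩ : ℕ) = t + 1
      have hmiss : ∀ {m n} (h' : m = n + multiE q) (τ : MultiHom m K) a, U m τ a →
          (τ.comp (coface h' a)).Misses q (t + 1) := by
        rintro m n h' τ a ⟨-, hinj, -, ha, hat⟩
        have := hinj.misses h' ⟨a, ha⟩ (by rwa [hat])
        rwa [hat] at this
      have hit : ∀ {m} (τ : MultiHom m K) a (hU : U m τ a), ∃ x : Fin (m q + 1),
          x ≠ ⟨a, hU.2.2.2.choose⟩ ∧ (τ q x : ℕ) = t := by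
        rintro m τ a hU
        have hhit := not_misses_of_not_doubledTame h ht hU.1 hU.2.1
        simp only [Misses, not_forall, not_not] at hhit
        obtain ⟨x, hx⟩ := hhit
        refine ⟨x, ?_, hx⟩
        rintro rfl
        have := hU.2.2.2.choose_spec
        omega
      obtain ⟨g, hg⟩ := PartialHom.exists_attach hX (hD N) f' q U (D' := D (N + 1))
        (by
          intro m τ a hU
          obtain ⟨x, hxa, hx⟩ := hit τ a hU
          have h1 := hU.2.2.2.choose
          have h2 : (x : ℕ) ≠ a := fun e => hxa (Fin.ext e)
          omega)
        (by
          intro m n h' τ a ha hU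
          obtain ⟨x, hxa, hx⟩ := hit τ a hU
          have hm := hmiss h' τ a hU
          obtain ⟨hns, hinj, hsz, ha', hat⟩ := hU
          have hsz' := size_of_eq_add_multiE h'
          rintro (((hs | hi) | hmt) | hlt)
          · have hs' : ((codegeneracy h t).comp τ).Surj := by
              by_contra hs'
              exact hns (Or.inl (Or.inl hs'))
            exact hs (hs'.comp_coface h' ⟨a, ha'⟩ x hxa (codegeneracy_val_eq_of h hx hat))
          · exact hns (Or.inl (Or.inr (InjOff.insert (a := ⟨a, ha'⟩) h' hat hm hi)))
          · obtain ⟨x', rfl⟩ := exists_coface_eq h' a ha q x (fun e => hxa (Fin.ext e.2))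
            exact hmt.1 x' hx
          · have := hlt.2.2 hm
            omega)
        (by
          rintro m n h' τ a ha a' hU ⟨-, -, -, ha', hat'⟩
          exact hmiss h' τ a hU _ hat')
        (by
          rintro m τ a ⟨hns, hinj, hsz, ha, hat⟩ p n h' i hi hne
          have hsz' := size_of_eq_add_multiE h'
          refine Or.inr ⟨hinj.comp_coface h' i, by omega, fun hm => ?_⟩
          obtain ⟨x', hx'⟩ := exists_coface_eq h' i hi q ⟨a, ha⟩ (by
            rintro ⟨rfl, e⟩
            simp only at e
            exact hne (by rw [e]))
          refine absurd hat ?_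
          rw [← hx']
          exact hm x')
        (by
          intro m n h' τ τ' a a' ha ha' hU hU' e
          exact insert_unique h' hU.2.2.2.choose_spec hU'.2.2.2.choose_spec (hmiss h' τ a hU) e)
        (by
          rintro n τ (hτ | ⟨hinj, hlt, hm⟩)
          · exact Or.inl (Or.inl hτ)
          by_cases hτ : DoubledTame h t W n τ
          · exact Or.inl (Or.inl hτ)
          by_cases hmw : τ.Misses q (t + 1)
          · have hlt' := hm hmw
            by_cases hN : size n + 1 < N
            · exact Or.inl (Or.inr ⟨hinj, by omega, fun _ => hN⟩)
            obtain ⟨τ', a, hat, hτ'⟩ := hmw.exists_insert (by omega) (rfl : n + multiE q = _)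
            have hsz : size (n + multiE q) = size n + 1 := size_of_eq_add_multiE rfl
            refine Or.inr (Or.inr ⟨_, rfl, τ', a, by omega, ⟨?_, ?_, by omega, a.2, hat⟩, hτ'⟩)
            · intro hd
              exact hτ (hτ' ▸ DoubledTame.faceClosed h t W q rfl a (by omega) τ' hd)
            · exact InjOff.insert rfl hat (by rwa [hτ']) (by rwa [hτ'])
          · by_cases hN : size n < N
            · exact Or.inl (Or.inr ⟨hinj, hN, fun hm => absurd hm hmw⟩)
            have hmw' := hmw
            simp only [Misses, not_forall, not_not] at hmw'
            obtain ⟨x, hx⟩ := hmw'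
            exact Or.inr (Or.inl ⟨x, hτ, hinj, by omega, x.2, hx⟩))
      exact ⟨g, hg⟩)
    -- Pulling back along the identity serves only to restrict the domain.
    (f.pullback (MultiHom.id K) zero)
  refine ⟨g.pullback (MultiHom.id K) ?_, fun n τ hτ => ?_⟩
  · rintro n τ (hτ | hτ)
    · exact ⟨0, Or.inl hτ⟩
    -- The stage `size n + 2` satisfies both bounds, whether or not `t + 1` is missed.
    · exact ⟨size n + 2, Or.inr ⟨hτ, by omega, fun _ => by omega⟩⟩
  · exact hg n τ (Or.inl hτ)

/-- After doubling `t`, the map `f` sits on the face omitting `t + 1`, and another map `f₁`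
restricts to sits on the face omitting `t`. The latter extends over repetitions in `W` by `ih`, and
`exists_extend_iterated` spreads this over the doubled multisimplex. On the face omitting `t + 1`, a
map repeating `t` as well as values in `W` repeats only values in `overInsert h t W`, so the
restriction to that face is the required extension of `f`. -/
theorem exists_extend_insert {X : MultiSemiSimplicialSet.{u} l} (hX : X.IsKan) {k : Fin l → ℕ}
    {q : Fin l} {t : ℕ} (ht : t ≤ k q) (W : Set (Fin l × ℕ))
    (ih : ∀ f : PartialHom (standard k) X (Tame ∅), ∃ g : PartialHom (standard k) X (Tame W),
      ∀ n θ hθ hθ', g.app (n := n) θ hθ' = f.app θ hθ)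
    (f : PartialHom (standard k) X (Tame ∅)) :
    ∃ g : PartialHom (standard k) X (Tame (insert (q, t) W)),
      ∀ n θ hθ hθ', g.app (n := n) θ hθ' = f.app θ hθ := by
  obtain ⟨K, h⟩ : ∃ K, K = k + multiE q := ⟨_, rfl⟩
  have hKq : K q = k q + 1 := by simpa using apply_of_eq_add_multiE h q
  have retract : ∀ i, i = t ∨ i = t + 1 → ∀ {n} (θ : MultiHom n k),
      (codegeneracy h t).comp ((coface h i).comp θ) = θ := fun i hi n θ => by
    rw [← comp_assoc, codegeneracy_comp_coface_self h hi, id_comp]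
  have dbl : ∀ i, i = t ∨ i = t + 1 → ∀ n (θ : MultiHom n k), Tame ∅ n θ →
      Doubled h t n ((coface h i).comp θ) := by
    rintro i hi n θ (hs | hinj)
    · exact Or.inl (by rwa [retract i hi])
    · exact Or.inr fun p x y hxy hne =>
        (hinj p x y (congrArg Fin.val (coface_injective h _ p (Fin.ext hxy))) hne).elim
  obtain ⟨f₁, hf₁⟩ := exists_extend_doubled hX h ht f
  obtain ⟨f₂, hf₂⟩ := ih (f₁.pullback (coface h t) (dbl t (Or.inl rfl)))
  obtain ⟨f₃, hf₃⟩ := PartialHom.exists_glue (Doubled.faceClosed h t)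
    (missesTame_faceClosed h t W) f₁
    (f₂.pullback (codegeneracy h t) (D' := fun n τ =>
      τ.Misses q t ∧ Tame W n ((codegeneracy h t).comp τ)) fun n τ hτ => hτ.2)
    (by
      intro n τ hτ hτ'
      have e : (coface h t).comp ((codegeneracy h t).comp τ) = τ :=
        coface_comp_codegeneracy_comp h (by omega) (Or.inl rfl) hτ'.1
      have htame : Tame ∅ n ((codegeneracy h t).comp τ) :=
        hτ.imp (fun hs => hs) (fun hi => hi.codegeneracy_comp h ht (Or.inl hτ'.1)
          (fun _ _ hx => hx.elim))
      refine Eq.trans ?_ (hf₂ n ((codegeneracy h t).comp τ) htame hτ'.2).symm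
      exact f₁.app_congr e.symm _ _)
  obtain ⟨f₄, hf₄⟩ := exists_extend_iterated hX h ht W f₃
  refine ⟨f₄.pullback (coface h (t + 1)) ?_, ?_⟩
  · rintro n θ (hs | hinj)
    · exact Or.inl (Or.inl (Or.inl (by rwa [retract _ (Or.inr rfl)])))
    · refine Or.inr fun p x y hxy hne => ⟨?_, _, rfl, ?_⟩
      · intro e
        obtain ⟨rfl, e⟩ := Prod.mk.inj e
        exact coface_misses h (t + 1) _ e
      · have e : (codegeneracy h t p (coface h (t + 1) p (θ p x)) : ℕ) = θ p x :=
          congrArg Fin.val (DFunLike.congr_fun (congrFun (retract _ (Or.inr rfl) θ) p) x)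
        have := hinj p x y (congrArg Fin.val (coface_injective h _ p (Fin.ext hxy))) hne
        rw [← e] at this
        exact this
  · intro n θ hθ hθ'
    have hd := dbl _ (Or.inr rfl) n θ hθ
    exact (hf₄ n _ (Or.inl hd)).trans ((hf₃ n _ hd).trans (hf₁ n θ hθ hd))

/-- A map from the standard semisimplicial multisimplex and the degeneracies of its faces extends
to all degeneracies. -/
theorem exists_extend_standard {X : MultiSemiSimplicialSet.{u} l} (hX : X.IsKan) {k : Fin l → ℕ}
    (f : PartialHom (standard k) X (Tame ∅)) :
    ∃ g : PartialHom (standard k) X (fun _ _ => True),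
      ∀ n θ hθ, g.app (n := n) θ trivial = f.app θ hθ := by
  classical
  have main : ∀ W : Finset (Fin l × ℕ), (∀ v ∈ W, v.2 ≤ k v.1) →
      -- The map must vary in the induction: the step uses the hypothesis for the map on the other
      -- face of the doubled multisimplex, not for `f`.
      ∀ f : PartialHom (standard k) X (Tame ∅),
      ∃ g : PartialHom (standard k) X (Tame (W : Set (Fin l × ℕ))),
        ∀ n θ hθ hθ', g.app (n := n) θ hθ' = f.app θ hθ := by
    intro W
    induction W using Finset.induction_on with
    | empty =>
      intro _ f
      rw [Finset.coe_empty]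
      exact ⟨f, fun _ _ _ _ => rfl⟩
    | insert v W _ ih =>
      intro hW f
      rw [Finset.coe_insert]
      exact exists_extend_insert hX (hW v (Finset.mem_insert_self v W)) W
        (ih fun v hv => hW v (Finset.mem_insert_of_mem hv)) f
  obtain ⟨g, hg⟩ := main
    (Finset.univ.biUnion fun p => (Finset.range (k p + 1)).image fun a => (p, a))
    (by
      intro v hv
      simp only [Finset.mem_biUnion, Finset.mem_univ, true_and, Finset.mem_image,
        Finset.mem_range] at hv
      obtain ⟨p, a, ha, rfl⟩ := hv
      exact Nat.lt_succ_iff.1 ha) f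
  refine ⟨g.pullback (MultiHom.id k) ?_, fun n θ hθ => hg n θ hθ _⟩
  intro n θ _
  refine Or.inr fun p x y _ _ => ?_
  simp only [Finset.coe_biUnion, Finset.coe_image, Set.mem_iUnion, Set.mem_image]
  exact ⟨p, by simp, θ p x, Finset.mem_coe.2 (Finset.mem_range.2 (θ p x).2), rfl⟩

/-! ### Surjective operators and their sections -/

theorem eq_of_le_of_size_le {n k : Fin l → ℕ} (h : ∀ p, k p ≤ n p) (hs : size n ≤ size k) :
    n = k := by
  have := (Finset.sum_eq_sum_iff_of_le (s := Finset.univ) (f := k) (g := n) fun p _ => h p).1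
    (le_antisymm (Finset.sum_le_sum fun p _ => h p) hs)
  funext p
  exact (this p (Finset.mem_univ p)).symm

namespace MultiHom

theorem Surj.surjective {n k : Fin l → ℕ} {θ : MultiHom n k} (h : θ.Surj) (p) :
    Function.Surjective (θ p) := fun a =>
  let ⟨x, hx⟩ := h p a (Nat.lt_succ_iff.1 a.2)
  ⟨x, Fin.ext hx⟩

theorem Surj.le {n k : Fin l → ℕ} {θ : MultiHom n k} (h : θ.Surj) (p) : k p ≤ n p := by
  simpa using Fintype.card_le_of_surjective _ (h.surjective p)

theorem InjOff.le {n k : Fin l → ℕ} {θ : MultiHom n k} (h : θ.InjOff ∅) (p) : n p ≤ k p := by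
  have hinj : Function.Injective (θ p) := fun x y hxy => by
    by_contra hne
    exact h p x y (congrArg Fin.val hxy) hne
  simpa using Fintype.card_le_of_injective _ hinj

theorem Surj.eq_id {n : Fin l → ℕ} {θ : MultiHom n n} (h : θ.Surj) : θ = MultiHom.id n := by
  funext p
  have hinj : Function.Injective (θ p) := Finite.injective_iff_surjective.2 (h.surjective p)
  have hs : StrictMono (θ p) := (θ p).monotone.strictMono_of_injective hinj
  have := (StrictMono.range_inj hs (strictMono_id : StrictMono (_root_.id : Fin (n p + 1) → _))).1
    (by rw [(h.surjective p).range_eq, Set.range_id])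
  ext x
  exact congrArg Fin.val (congrFun this x)

/-- Any right inverse of a monotone surjection of chains is monotone, so its value at one point can
be prescribed freely in the fibre. -/
theorem exists_section {a b : ℕ} {φ : Fin (a + 1) →o Fin (b + 1)} (h : Function.Surjective φ)
    (x : Fin (a + 1)) : ∃ δ : Fin (b + 1) →o Fin (a + 1), (∀ y, φ (δ y) = y) ∧ δ (φ x) = x := by
  let g : Fin (b + 1) → Fin (a + 1) := Function.update (Function.surjInv h) (φ x) x
  have hg : ∀ y, φ (g y) = y := by
    intro y
    by_cases hy : y = φ x
    · subst hy
      simp [g]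
    · simp [g, hy, Function.surjInv_eq]
  refine ⟨⟨g, fun y z hyz => ?_⟩, hg, Function.update_self ..⟩
  by_contra hlt
  have h1 := φ.monotone (le_of_not_ge hlt)
  rw [hg, hg] at h1
  exact hlt (le_of_eq (congrArg g (le_antisymm hyz h1)))

theorem Surj.exists_section {n k : Fin l → ℕ} {θ : MultiHom n k} (h : θ.Surj)
    (x : ∀ p, Fin (n p + 1)) :
    ∃ δ : MultiHom k n, θ.comp δ = MultiHom.id k ∧ ∀ p, δ p (θ p (x p)) = x p := by
  choose δ h1 h2 using fun p => MultiHom.exists_section (h.surjective p) (x p)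
  exact ⟨δ, ext_val fun p y => congrArg Fin.val (h1 p y), h2⟩

theorem injOff_of_comp_eq_id {n k : Fin l → ℕ} {θ : MultiHom n k} {δ : MultiHom k n}
    (h : θ.comp δ = MultiHom.id k) : δ.InjOff ∅ := by
  intro p x y hxy hne
  refine (hne ?_).elim
  have h1 : ∀ x, θ p (δ p x) = x := fun x => DFunLike.congr_fun (congrFun h p) x
  rw [← h1 x, ← h1 y, Fin.ext hxy]

end MultiHom

/-! ### The action of operators, by induction on total degree -/

/-- Maps to `X` from all multisimplices, degenerate ones included, of a standard multisimplex. -/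
abbrev FullHom (k : Fin l → ℕ) (X : MultiSemiSimplicialSet.{u} l) :=
  PartialHom (standard k) X (fun _ _ => True)

/-- The value of a map at a multisimplex. -/
def FullHom.eval {k : Fin l → ℕ} {X : MultiSemiSimplicialSet.{u} l} (F : FullHom k X)
    {n : Fin l → ℕ} (θ : MultiHom n k) : X.obj n :=
  F.app θ trivial

variable {X : MultiSemiSimplicialSet.{u} l}

theorem FullHom.d_eval {k : Fin l → ℕ} (F : FullHom k X) {p : Fin l} {m n : Fin l → ℕ}
    (h : m = n + multiE p) (i : ℕ) (hi : i ≤ m p) (θ : MultiHom m k) :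
    X.d p h i hi (F.eval θ) = F.eval (θ.comp (coface h i)) :=
  F.comm p h i hi θ trivial trivial

/-- An injective operator is a composite of cofaces, and along these both maps are computed by the
face maps of `X` from the common value. -/
theorem FullHom.eval_comp_eq_of_injOff {a b : Fin l → ℕ} (F : FullHom a X) (G : FullHom b X)
    {k n : Fin l → ℕ} {θ : MultiHom k a} {θ' : MultiHom k b} (e : F.eval θ = G.eval θ')
    {δ : MultiHom n k} (hδ : δ.InjOff ∅) : F.eval (θ.comp δ) = G.eval (θ'.comp δ) := by
  induction hN : size k generalizing k with
  | zero =>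
    have hle : ∀ p, n p ≤ k p := hδ.le
    obtain rfl := eq_of_le_of_size_le hle (by omega)
    have hs : δ.Surj := by
      intro p b hb
      have : k p ≤ size k := Finset.single_le_sum (fun _ _ => Nat.zero_le _) (Finset.mem_univ p)
      exact ⟨0, by have := (δ p 0).2; omega⟩
    rw [hs.eq_id]
    exact e
  | succ N ih =>
    by_cases hs : δ.Surj
    · obtain rfl : n = k := eq_of_le_of_size_le hs.le (Finset.sum_le_sum fun p _ => hδ.le p)
      rw [hs.eq_id]
      exact e
    · obtain ⟨p, i, hi, hm⟩ := misses_of_not_surj hs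
      obtain ⟨c, h, δ', rfl⟩ := hm.exists_factor hi
      have hsz := size_of_eq_add_multiE h
      rw [← comp_assoc, ← comp_assoc]
      refine ih ?_ ?_ (by omega)
      · rw [← F.d_eval h i hi, ← G.d_eval h i hi, e]
      · intro q x y hxy hne
        refine hδ q x y ?_ hne
        rw [comp_apply, comp_apply, Fin.ext hxy]

/-- Degeneracies of the simplices of `X` of total degree less than `N`. -/
structure DegeneracyStage (X : MultiSemiSimplicialSet.{u} l) (N : ℕ) where
  /-- The action of all operators on a simplex. -/
  op : ∀ {k : Fin l → ℕ}, size k < N → X.obj k → FullHom k X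
  op_id : ∀ {k : Fin l → ℕ} (hk : size k < N) (x : X.obj k), (op hk x).eval (MultiHom.id k) = x
  op_comp : ∀ {k n m : Fin l → ℕ} (hk : size k < N) (hn : size n < N) (x : X.obj k)
    (θ : MultiHom n k) (η : MultiHom m n),
    (op hn ((op hk x).eval θ)).eval η = (op hk x).eval (θ.comp η)

namespace DegeneracyStage

variable {N : ℕ} (S : DegeneracyStage X N)

theorem op_coface {p : Fin l} {k c : Fin l → ℕ} (h : k = c + multiE p) (hk : size k < N)
    (hc : size c < N) (x : X.obj k) (i : ℕ) (hi : i ≤ k p) {n : Fin l → ℕ} (ρ : MultiHom n c) :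
    (S.op hk x).eval ((coface h i).comp ρ) = (S.op hc (X.d p h i hi x)).eval ρ := by
  have e : X.d p h i hi x = (S.op hk x).eval (coface h i) := by
    conv_lhs => rw [← S.op_id hk x]
    exact FullHom.d_eval _ h i hi _
  rw [e, S.op_comp]

theorem exists_reduce {a k : Fin l → ℕ} (ha : size a < N) (y : X.obj a) {θ : MultiHom k a}
    (hθ : ¬ θ.Surj) : ∃ c, ∃ hc : size c < N, size c < size a ∧ ∃ (z : X.obj c) (θ' : MultiHom k c),
      ∀ {n} (η : MultiHom n k), (S.op ha y).eval (θ.comp η) = (S.op hc z).eval (θ'.comp η) := by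
  obtain ⟨p, i, hi, hm⟩ := misses_of_not_surj hθ
  obtain ⟨c, h, θ', rfl⟩ := hm.exists_factor hi
  have hsz := size_of_eq_add_multiE h
  exact ⟨c, by omega, by omega, X.d p h i hi y, θ', fun η => S.op_coface h ha _ y i hi (θ'.comp η)⟩

/-- The degeneracies of a degenerate simplex do not depend on how it is written. -/
theorem eval_comp_eq {a b k n : Fin l → ℕ} (ha : size a < N) (hb : size b < N)
    (y : X.obj a) (y' : X.obj b) (θ : MultiHom k a) (θ' : MultiHom k b)
    (e : (S.op ha y).eval θ = (S.op hb y').eval θ') (η : MultiHom n k) :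
    (S.op ha y).eval (θ.comp η) = (S.op hb y').eval (θ'.comp η) := by
  -- This is the Eilenberg–Zilber argument: whenever `y` or `y'` can be replaced by a simplex of
  -- lower degree, the induction hypothesis applies.
  induction hM : size a + size b using Nat.strong_induction_on generalizing a b with
  | _ M ih =>
  by_cases hs : θ.Surj
  swap
  · obtain ⟨c, hc, hlt, z, ζ, hz⟩ := S.exists_reduce ha y hs
    rw [hz]
    exact ih _ (by omega) hc hb z y' ζ θ' ((hz (MultiHom.id k)).symm.trans e) rfl
  by_cases hs' : θ'.Surj
  swap
  · obtain ⟨c, hc, hlt, z, ζ, hz⟩ := S.exists_reduce hb y' hs'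
    rw [hz]
    exact ih _ (by omega) ha hc y z θ ζ (e.trans (hz (MultiHom.id k))) rfl
  wlog hle : size b ≤ size a generalizing a b
  · exact (this hb ha y' y θ' θ e.symm (by omega) hs' hs (by omega)).symm
  -- Sections are injective, so restricting `e` along a section of `θ` needs only face maps and
  -- expresses `y` through `y'`.
  have hy : ∀ δ : MultiHom a k, θ.comp δ = MultiHom.id a → y = (S.op hb y').eval (θ'.comp δ) := by
    intro δ hδ
    have := FullHom.eval_comp_eq_of_injOff _ _ e (injOff_of_comp_eq_id hδ)
    rwa [hδ, S.op_id] at this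
  have reduce : ∀ c, ∀ hc : size c < N, size c < size a → ∀ (z : X.obj c) (α : MultiHom a c),
      y = (S.op hc z).eval α → (S.op ha y).eval (θ.comp η) = (S.op hb y').eval (θ'.comp η) := by
    intro c hc hlt z α hα
    have hz : ∀ {m} (ζ : MultiHom m a), (S.op ha y).eval ζ = (S.op hc z).eval (α.comp ζ) := by
      intro m ζ
      rw [hα, S.op_comp]
    rw [hz, ← comp_assoc]
    exact ih _ (by omega) hc hb z y' (α.comp θ) θ' ((hz θ).symm.trans e) rfl
  by_cases hlt : size b < size a
  · obtain ⟨δ, hδ, -⟩ := hs.exists_section (fun _ => 0)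
    exact reduce b hb hlt y' _ (hy δ hδ)
  by_cases hred : ∃ δ : MultiHom a k, θ.comp δ = MultiHom.id a ∧ ¬ (θ'.comp δ).Surj
  · obtain ⟨δ, hδ, hns⟩ := hred
    obtain ⟨c, hc, hlt, z, ζ, hz⟩ := S.exists_reduce hb y' hns
    exact reduce c hc (by omega) z ζ ((hy δ hδ).trans (hz (MultiHom.id a)))
  push Not at hred
  obtain ⟨δ, hδ, -⟩ := hs.exists_section (fun _ => 0)
  obtain rfl := eq_of_le_of_size_le (hred δ hδ).le (by omega)
  have hy' : y = y' := by
    rw [hy δ hδ, (hred δ hδ).eq_id, S.op_id]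
  -- Every section of `θ` is now also a section of `θ'`. Each position lies in the image of some
  -- section of `θ`, so the two maps agree there.
  have hθ : θ = θ' := by
    refine ext_val fun p x => ?_
    classical
    obtain ⟨δ, hδ, hx⟩ := hs.exists_section (Function.update (fun _ => 0) p x)
    have hid : ∀ v, θ' p (δ p v) = v := fun v =>
      DFunLike.congr_fun (congrFun (hred δ hδ).eq_id p) v
    have := hid (θ p x)
    have hxp := hx p
    rw [Function.update_self] at hxp
    rw [hxp] at this
    exact (congrArg Fin.val this).symm
  rw [hy', hθ]

/-- An operator factoring through two different cofaces factors through a face of codimension two,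
where the two iterated faces of `x` agree. Only face identities are used for `x` itself, since no
operators act on degree `N` yet. -/
theorem eval_face_eq {k : Fin l → ℕ} (hk : size k = N) (x : X.obj k) {p q : Fin l}
    {c c' n : Fin l → ℕ} (h : k = c + multiE p) (h' : k = c' + multiE q) (hc : size c < N)
    (hc' : size c' < N) (i j : ℕ) (hi : i ≤ k p) (hj : j ≤ k q) (θ : MultiHom n c)
    (θ' : MultiHom n c') (e : (coface h i).comp θ = (coface h' j).comp θ') :
    (S.op hc (X.d p h i hi x)).eval θ = (S.op hc' (X.d q h' j hj x)).eval θ' := by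
  have hsz := size_of_eq_add_multiE h
  by_cases hpq : p = q
  · subst hpq
    have hkp : k p = c p + 1 := by simpa using apply_of_eq_add_multiE h p
    obtain rfl : c = c' := add_right_cancel (h.symm.trans h')
    wlog hij : i ≤ j generalizing i j θ θ'
    · exact (this (i := j) (j := i) (hi := hj) (hj := hi) (θ := θ') (θ' := θ) (e := e.symm)
        (by omega)).symm
    rcases hij.eq_or_lt with rfl | hij
    · rw [comp_coface_cancel h i e]
    have hm : θ.Misses p (j - 1) := by
      intro v hv
      have hv' : (coface h j p (θ' p v) : ℕ) = coface h i p (θ p v) :=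
        congrArg Fin.val (DFunLike.congr_fun (congrFun e p) v).symm
      refine coface_misses h j _ (hv'.trans ?_)
      rw [coface_val, hv]
      simp only [true_and]
      split_ifs <;> omega
    obtain ⟨b, hb, ρ, rfl⟩ := hm.exists_factor (by omega)
    have hcp : c p = b p + 1 := by simpa using apply_of_eq_add_multiE hb p
    have hszb := size_of_eq_add_multiE hb
    rw [← comp_assoc, ← coface_comp_coface_same h hb hij, comp_assoc] at e
    rw [← comp_coface_cancel h j e, S.op_coface hb hc (by omega) _ _ (by omega),
      S.op_coface hb hc (by omega) _ _ (by omega),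
      X.d_d_same p h hb i j hij hj (by omega) hi (by omega)]
  · have hkq : k q = c q := by simpa [Ne.symm hpq] using apply_of_eq_add_multiE h q
    have hm : θ.Misses q j := by
      intro v hv
      have hv' : (coface h' j q (θ' q v) : ℕ) = coface h i q (θ q v) :=
        congrArg Fin.val (DFunLike.congr_fun (congrFun e q) v).symm
      refine coface_misses h' j _ (hv'.trans ?_)
      rw [coface_val, hv]
      simp [Ne.symm hpq]
    obtain ⟨b, hb, ρ, rfl⟩ := hm.exists_factor (by omega)
    have hb' : c' = b + multiE p := by
      refine add_right_cancel (b := multiE q) ?_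
      rw [← h', h, hb, add_assoc, add_assoc, add_comm (multiE p)]
    have hkp : k p = c' p := by simpa [hpq] using apply_of_eq_add_multiE h' p
    have hszb := size_of_eq_add_multiE hb
    rw [← comp_assoc, ← coface_comp_coface_ne hpq h' hb' h hb, comp_assoc] at e
    rw [← comp_coface_cancel h' j e, S.op_coface hb hc (by omega) _ _ (by omega),
      S.op_coface hb' hc' (by omega) _ _ (by omega),
      X.d_d_ne p q hpq h' hb' h hb i j hj (by omega) hi (by omega)]

/-- If `x` comes from a lower simplex, its action is taken from there, and `eval_comp_eq` makes the
choice irrelevant. Otherwise the second condition is vacuous, and the action is any extension of the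
one prescribed by `x` and its faces. -/
theorem exists_degeneracies (hX : X.IsKan) {k : Fin l → ℕ} (hk : size k = N) (x : X.obj k) :
    ∃ F : FullHom k X, F.eval (MultiHom.id k) = x ∧
      (∀ {a n} (ha : size a < N) (y : X.obj a) (θ : MultiHom k a) (η : MultiHom n k),
        (S.op ha y).eval θ = x → F.eval η = (S.op ha y).eval (θ.comp η)) ∧
      ∀ (p : Fin l) {c n : Fin l → ℕ} (h : k = c + multiE p) (hc : size c < N) (i : ℕ)
        (hi : i ≤ k p) (ρ : MultiHom n c),
        F.eval ((coface h i).comp ρ) = (S.op hc (X.d p h i hi x)).eval ρ := by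
  by_cases hdeg : ∃ a, ∃ ha : size a < N, ∃ (y : X.obj a) (θ : MultiHom k a),
      (S.op ha y).eval θ = x
  · obtain ⟨a, ha, y, θ, rfl⟩ := hdeg
    refine ⟨(S.op ha y).pullback θ (fun _ _ _ => trivial), rfl, ?_, ?_⟩
    · intro b n hb y' θ' η e
      exact (S.eval_comp_eq hb ha y' y θ' θ e η).symm
    · intro p c n h hc i hi ρ
      rw [FullHom.d_eval, S.op_comp]
      rfl
  have lt : ∀ {p : Fin l} {c : Fin l → ℕ}, k = c + multiE p → size c < N := fun h => by
    have := size_of_eq_add_multiE h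
    omega
  obtain ⟨f, hf⟩ := PartialHom.exists_of_rel (Y := standard k) (X := X) (D := Tame ∅)
    (fun n θ z => (∃ p c, ∃ h : k = c + multiE p, ∃ i, ∃ hi : i ≤ k p, ∃ ρ : MultiHom n c,
      (coface h i).comp ρ = θ ∧ (S.op (lt h) (X.d p h i hi x)).eval ρ = z) ∨
      -- On `Tame ∅` a surjective operator is also injective, hence the identity. `HEq` is needed
      -- because `n = k` is only a propositional equality.
      (n = k ∧ Surj θ ∧ HEq z x))
    (by
      rintro n θ hθ
      by_cases hs : Surj θ
      · have hinj := hθ.resolve_left (fun h => h hs)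
        obtain rfl : n = k := eq_of_le_of_size_le hs.le (Finset.sum_le_sum fun p _ => hinj.le p)
        exact ⟨x, Or.inr ⟨rfl, hs, HEq.rfl⟩⟩
      · obtain ⟨p, i, hi, hm⟩ := misses_of_not_surj hs
        obtain ⟨c, h, ρ, rfl⟩ := hm.exists_factor hi
        exact ⟨_, Or.inl ⟨p, c, h, i, hi, ρ, rfl, rfl⟩⟩)
    (by
      rintro n θ z z' (⟨p, c, h, i, hi, ρ, rfl, rfl⟩ | ⟨rfl, hs, hz⟩)
        (⟨p', c', h', i', hi', ρ', e, rfl⟩ | ⟨e, hs', hz'⟩)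
      · exact S.eval_face_eq hk x h h' _ _ i i' hi hi' ρ ρ' e.symm
      · exact (((coface_misses h i).comp ρ).not_surj hi hs').elim
      · subst e
        exact (((coface_misses h' i').comp ρ').not_surj hi' hs).elim
      · exact eq_of_heq (hz.trans hz'.symm))
    (by
      rintro p m n h i hi θ z (⟨p', c, h', i', hi', ρ, rfl, rfl⟩ | ⟨rfl, hs, hz⟩)
      · exact Or.inl ⟨p', c, h', i', hi', ρ.comp (coface h i), rfl, (FullHom.d_eval _ _ _ _ _).symm⟩
      · obtain rfl := eq_of_heq hz
        refine Or.inl ⟨p, n, h, i, hi, MultiHom.id n, ?_, S.op_id _ _⟩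
        rw [hs.eq_id]
        rfl)
  obtain ⟨F, hF⟩ := exists_extend_standard hX f
  have hidT : Tame ∅ k (MultiHom.id k) := Or.inr fun p x y hxy hne => (hne (Fin.ext hxy)).elim
  have hidS : Surj (MultiHom.id k) := fun p a ha => ⟨⟨a, by omega⟩, rfl⟩
  refine ⟨F, ?_, ?_, ?_⟩
  · exact (hF k _ hidT).trans (hf k _ _ x (Or.inr ⟨rfl, hidS, HEq.rfl⟩))
  · intro a n ha y θ η e
    exact (hdeg ⟨a, ha, y, θ, e⟩).elim
  · intro p c n h hc i hi ρ
    have hT : Tame ∅ n ((coface h i).comp ρ) :=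
      Or.inl (((coface_misses h i).comp ρ).not_surj hi)
    exact (hF n _ hT).trans (hf n _ hT _ (Or.inl ⟨p, c, h, i, hi, ρ, rfl, rfl⟩))

/-- Functoriality at a new simplex reduces to the old stage: an operator from degree at most `N` to
degree `N` is either the identity or non-surjective, and in the latter case it acts through a face.
The result may again have degree `N`, and then the compatibility with lower presentations in
`exists_degeneracies` applies. -/
theorem exists_succ (hX : X.IsKan) : ∃ S' : DegeneracyStage X (N + 1),
    ∀ {k} (hk : size k < N) (hk' : size k < N + 1) (x : X.obj k), S'.op hk' x = S.op hk x := by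
  classical
  choose F hid hdeg hface using fun (k : Fin l → ℕ) (hk : size k = N) (x : X.obj k) =>
    S.exists_degeneracies hX hk x
  let op : ∀ {k : Fin l → ℕ}, size k < N + 1 → X.obj k → FullHom k X := fun {k} hk x =>
    if h : size k < N then S.op h x else F k (by omega) x
  have op_lt : ∀ {k} (hk : size k < N) (hk' : size k < N + 1) (x : X.obj k),
      op hk' x = S.op hk x := fun hk _ _ => dif_pos hk
  have op_eq : ∀ {k} (hk : size k = N) (hk' : size k < N + 1) (x : X.obj k),
      op hk' x = F k hk x := fun hk _ _ => dif_neg (by omega)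
  have key : ∀ {a n m} (ha : size a < N) (hn : size n < N + 1) (y : X.obj a) (β : MultiHom n a)
      (η : MultiHom m n),
      (op hn ((S.op ha y).eval β)).eval η = (S.op ha y).eval (β.comp η) := by
    intro a n m ha hn y β η
    by_cases h : size n < N
    · rw [op_lt h hn, S.op_comp]
    · rw [op_eq (by omega) hn]
      exact hdeg n _ _ ha y β η rfl
  refine ⟨⟨op, ?_, ?_⟩, op_lt⟩
  · intro k hk x
    by_cases h : size k < N
    · rw [op_lt h hk, S.op_id]
    · rw [op_eq (by omega) hk, hid]
  · intro k n m hk hn x θ η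
    by_cases h : size k < N
    · rw [op_lt h hk]
      exact key h hn x θ η
    · rw [op_eq (by omega) hk]
      by_cases hs : θ.Surj
      · obtain rfl : n = k := eq_of_le_of_size_le hs.le (by omega)
        rw [hs.eq_id, hid, op_eq (by omega) hn]
        rfl
      · obtain ⟨p, i, hi, hm⟩ := misses_of_not_surj hs
        obtain ⟨c, h', θ', rfl⟩ := hm.exists_factor hi
        have hsz := size_of_eq_add_multiE h'
        rw [comp_assoc, hface k _ x p h' (by omega) i hi, hface k _ x p h' (by omega) i hi]
        exact key _ hn _ θ' η

end DegeneracyStage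

/-- A Kan multisemisimplicial set has an action of all operators that extends the face maps. -/
theorem IsKan.exists_op (hX : X.IsKan) : ∃ op : ∀ {k : Fin l → ℕ}, X.obj k → FullHom k X,
    (∀ {k} (x : X.obj k), (op x).eval (MultiHom.id k) = x) ∧
    ∀ {k n m : Fin l → ℕ} (x : X.obj k) (θ : MultiHom n k) (η : MultiHom m n),
      (op ((op x).eval θ)).eval η = (op x).eval (θ.comp η) := by
  choose next hnext using fun N (S : DegeneracyStage X N) => S.exists_succ hX
  let S₀ : DegeneracyStage X 0 :=
    ⟨fun h => absurd h (Nat.not_lt_zero _), fun h => absurd h (Nat.not_lt_zero _),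
      fun h => absurd h (Nat.not_lt_zero _)⟩
  let S : ∀ N, DegeneracyStage X N := fun N => Nat.rec S₀ next N
  have coh : ∀ {M N : ℕ}, M ≤ N → ∀ {k} (hk : size k < M) (hk' : size k < N) (x : X.obj k),
      (S N).op hk' x = (S M).op hk x := by
    intro M N h
    induction h with
    | refl => exact fun _ _ _ => rfl
    | step hN ih =>
      intro k hk hk' x
      rw [← ih hk (lt_of_lt_of_le hk hN) x]
      exact hnext _ _ _ hk' x
  -- Each simplex uses the first stage at which it is covered; `coh` allows any two simplices to be
  -- compared at a common later stage.
  refine ⟨fun {k} x => (S (size k + 1)).op (Nat.lt_succ_self _) x, fun {k} x => (S _).op_id _ x, ?_⟩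
  intro k n m x θ η
  simp only
  have hk : size k < max (size k + 1) (size n + 1) := by omega
  have hn : size n < max (size k + 1) (size n + 1) := by omega
  rw [← coh (le_max_left _ _) _ hk, ← coh (le_max_right _ _) _ hn, (S _).op_comp]

end MultiSemiSimplicialSet

/-! ### Degeneracies as the action of codegeneracies -/

theorem theorem2 {l : ℕ} (X : MultiSemiSimplicialSet.{u} l) (hX : X.IsKan) :
    ∃ s : (∀ (q : Fin l) {n m : Fin l → ℕ}, m = n + multiE q →
        ∀ j : ℕ, j ≤ n q → X.obj n → X.obj m),
      -- `d_i^q s_j^q = s_{j-1}^q d_i^q` for `i < j`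
      (∀ (q : Fin l) {c n m : Fin l → ℕ} (hn : n = c + multiE q) (hm : m = n + multiE q)
        (i j : ℕ) (_ : i < j) (hj : j ≤ n q) (hi : i ≤ m q) (hi' : i ≤ n q) (hj' : j - 1 ≤ c q)
        (x : X.obj n),
        X.d q hm i hi (s q hm j hj x) = s q hn (j - 1) hj' (X.d q hn i hi' x)) ∧
      -- `d_i^q s_j^q x = x` for `i = j, j + 1`
      (∀ (q : Fin l) {n m : Fin l → ℕ} (hm : m = n + multiE q)
        (i j : ℕ) (_ : i = j ∨ i = j + 1) (hj : j ≤ n q) (hi : i ≤ m q) (x : X.obj n),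
        X.d q hm i hi (s q hm j hj x) = x) ∧
      -- `d_i^q s_j^q = s_j^q d_{i-1}^q` for `i > j + 1`
      (∀ (q : Fin l) {c n m : Fin l → ℕ} (hn : n = c + multiE q) (hm : m = n + multiE q)
        (i j : ℕ) (_ : j + 1 < i) (hj : j ≤ n q) (hi : i ≤ m q) (hi' : i - 1 ≤ n q)
        (hj' : j ≤ c q) (x : X.obj n),
        X.d q hm i hi (s q hm j hj x) = s q hn j hj' (X.d q hn (i - 1) hi' x)) ∧
      -- `s_j^q s_i^q = s_i^q s_{j-1}^q` for `i < j`
      (∀ (q : Fin l) {n m k : Fin l → ℕ} (hm : m = n + multiE q) (hk : k = m + multiE q)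
        (i j : ℕ) (_ : i < j) (hi : i ≤ n q) (hj : j ≤ m q) (hj' : j - 1 ≤ n q) (hi' : i ≤ m q)
        (x : X.obj n),
        s q hk j hj (s q hm i hi x) = s q hk i hi' (s q hm (j - 1) hj' x)) ∧
      -- `d_i^p s_j^q = s_j^q d_i^p` for `p ≠ q`
      (∀ (p q : Fin l) (_ : p ≠ q) {n m c k : Fin l → ℕ}
        (hm : m = n + multiE q) (hm' : m = k + multiE p)
        (hn : n = c + multiE p) (hk : k = c + multiE q)
        (i j : ℕ) (hj : j ≤ n q) (hi : i ≤ m p) (hi' : i ≤ n p) (hj' : j ≤ c q) (x : X.obj n),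
        X.d p hm' i hi (s q hm j hj x) = s q hk j hj' (X.d p hn i hi' x)) ∧
      -- `s_i^p s_j^q = s_j^q s_i^p` for `p ≠ q`
      (∀ (p q : Fin l) (_ : p ≠ q) {n m m' k : Fin l → ℕ}
        (hm : m = n + multiE q) (hk : k = m + multiE p)
        (hm' : m' = n + multiE p) (hk' : k = m' + multiE q)
        (i j : ℕ) (hj : j ≤ n q) (hi : i ≤ m p) (hi' : i ≤ n p) (hj' : j ≤ m' q) (x : X.obj n),
        s p hk i hi (s q hm j hj x) = s q hk' j hj' (s p hm' i hi' x)) := by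
  obtain ⟨op, op_id, op_comp⟩ := hX.exists_op
  have d_eq : ∀ (p : Fin l) {m n : Fin l → ℕ} (h : m = n + multiE p) (i : ℕ) (hi : i ≤ m p)
      (x : X.obj m), X.d p h i hi x = (op x).eval (MultiSemiSimplicialSet.MultiHom.coface h i) := by
    intro p m n h i hi x
    conv_lhs => rw [← op_id x]
    exact MultiSemiSimplicialSet.FullHom.d_eval _ h i hi _
  refine ⟨fun q {n m} hm j _ x => (op x).eval (MultiSemiSimplicialSet.MultiHom.codegeneracy hm j),
    ?_, ?_, ?_, ?_, ?_, ?_⟩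
  · intro q c n m hn hm i j hij hj hi hi' hj' x
    simp only [MultiSemiSimplicialSet.FullHom.d_eval]
    rw [d_eq, op_comp, MultiSemiSimplicialSet.MultiHom.codegeneracy_comp_coface_lt hn hm hij hj]
  · intro q n m hm i j hij hj hi x
    simp only [MultiSemiSimplicialSet.FullHom.d_eval]
    rw [MultiSemiSimplicialSet.MultiHom.codegeneracy_comp_coface_self hm hij, op_id]
  · intro q c n m hn hm i j hij hj hi hi' hj' x
    simp only [MultiSemiSimplicialSet.FullHom.d_eval]
    rw [d_eq, op_comp, MultiSemiSimplicialSet.MultiHom.codegeneracy_comp_coface_gt hn hm hij hi]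
  · intro q n m k hm hk i j hij hi hj hj' hi' x
    simp only [op_comp]
    rw [MultiSemiSimplicialSet.MultiHom.codegeneracy_comp_codegeneracy_same hm hk hij hj]
  · intro p q hpq n m c k hm hm' hn hk i j hj hi hi' hj' x
    simp only [MultiSemiSimplicialSet.FullHom.d_eval]
    rw [d_eq, op_comp, MultiSemiSimplicialSet.MultiHom.codegeneracy_comp_coface_ne hpq hm hm' hn hk
      i j hi']
  · intro p q hpq n m m' k hm hk hm' hk' i j hj hi hi' hj' x
    simp only [op_comp]
    rw [MultiSemiSimplicialSet.MultiHom.codegeneracy_comp_codegeneracy_ne hpq hm hk hm' hk' i j]
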